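/- **Conventions.** For a semigroup $S$, let $S^1$ be $S$ with an identity adjoined. For $x,y\in S$ and $z_1,z_2,\ldots\in S^1$ put $\lambda_0=x$, $\rho_0=y$, $\lambda_{n+1}=\lambda_n z_{n+1}\rho_n$, $\rho_{n+1}=\rho_n z_{n+1}\lambda_n$, where $\lambda_n=\lambda_n(x,y,z_1,\ldots,z_n)$ and $\rho_n=\rho_n(x,y,z_1,\ldots,z_n)$. A semigroup $S$ is *nilpotent* (in the sense of Mal'cev) if for some $n\ge 1$ one has $\lambda_n(a,b,c_1,\ldots,c_n)=\rho_n(a,b,c_1,\ldots,c_n)$ for all $a,b\in S$ and $c_1,\ldots,c_n\in S^1$. The *upper non-nilpotent graph* $\mathcal N_S$ has vertex set $S$, with an edge between $x$ and $y$ when the subsemigroup $\langle x,y\rangle$ is not nilpotent. The empty set counts as an ideal, $S/I$ denotes the Rees factor semigroup, and $S/\emptyset=S$. A semigroup $S$ is *pseudo-nilpotent* if the following holds for all $x,y\in S$, all integers $0\le t<m$, all $w_1,\ldots,w_m\in S^1$ and every (possibly empty) ideal $I$ of $T=\langle x,y,w_1,\ldots,w_m\rangle$ (generators equal to the adjoined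 identity are omitted). Write $\lambda_i=\lambda_i(x,y,w_1,\ldots,w_i)$ and $\rho_i=\rho_i(x,y,w_1,\ldots,w_i)$. If $\lambda_t\ne\rho_t$, $(\lambda_t,\rho_t)=(\lambda_m,\rho_m)$ and $\lambda_m,\rho_m\notin I$, then for every $0\le i\le m$ there is an edge in $\mathcal N_{T/I}$ between $\lambda_i$ and $\rho_i$. Let $S$ be a (non-empty) finite semigroup with principal series $S=S_1\supset S_2\supset\cdots\supset S_m\supset S_{m+1}=\emptyset$; that is, each $S_i$ is an ideal of $S$, the inclusions are strict, and no ideal of $S$ lies strictly between $S_{i+1}$ and $S_i$. For $1\le i\le m$ define the following. * $F_i$ is the set of all $s\in S\setminus S_i$ such that $sj\notin S_{i+1}$ or $js\notin S_{i+1}$ for some $j\in S_i$. * $S^{(i)}$ is the union of the sets $S_j\setminus S_{j+1}$ over all $j\le i$ with $S_j\setminus S_{j+1}\subseteq F_i\cup(S_i\setminus S_{i+1})$. * $S_i\setminus S_{i+1}$ is a *root* if $S_i/S_{i+1}$ is not nilpotent and $\mathcal N_S$ has no edge between an element of $S_i\setminus S_{i+1}$ and an element of $S_{i+1}$. In this case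 $S^{(i)}$ is called a *stem*. * $S_i\setminus S_{i+1}$ is an *isolated subset* if it is not a root and $S_j/S_{j+1}$ is nilpotent for every $j$ with $S_i\setminus S_{i+1}\subseteq F_j$. Let $K$ be the union of all isolated subsets. * $S_j\setminus S_{j+1}$ is a *connection* between two distinct stems $S^{(i_1)}\neq S^{(i_2)}$ if $S_j\setminus S_{j+1}\subseteq S^{(i_1)}\cap S^{(i_2)}$. A subset of $S$ is called connected if the subgraph of $\mathcal N_S$ induced on it is connected, and paths in a subset are paths of this induced subgraph. **Corollary.** Let $S$ be a (non-empty) pseudo-nilpotent finite semigroup with a principal series as above. Then: 1. Every stem is connected, and any two distinct elements of a stem are connected by a path in the stem of length at most $2$. 2. If $K$ is empty, then $S=S^{(i)}$ for some root $S_i\setminus S_{i+1}$, the graph $\mathcal N_S$ is connected, and any two distinct vertices are connected by a path of length at most $2$. 3. If $S$ does not have any connections, then every connected component of $\mathcal N_S$ with more than one element is a stem and is a subsemigroup of $S$. 4. The union of two (distinct) stems that have a connection is a connected subset of $\mathcal N_S$, and every shortest path in this union (between any two of its elements) has length at most $4$. -/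

import Mathlib

/-- For `a, b` in a semigroup `S` and `w ∈ S¹`, the product `a * w * b`, as an element of `S`. -/
def sandwich {S : Type*} [Semigroup S] (a : S) (w : WithOne S) (b : S) : S :=
  WithOne.recOneCoe (motive := fun _ => S) (a * b) (fun z => a * z * b) w

/-- The pair `(λ_n, ρ_n)` of Mal'cev words `λ_n(x, y, z_1, …, z_n)`, `ρ_n(x, y, z_1, …, z_n)`:
`λ_0 = x`, `ρ_0 = y`, `λ_{n+1} = λ_n z_{n+1} ρ_n`, `ρ_{n+1} = ρ_n z_{n+1} λ_n`.
Here `z_{k+1}` is written `w k`; only `w 0, …, w (n - 1)` are used. -/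
def malcevPair {S : Type*} [Semigroup S] (x y : S) (w : ℕ → WithOne S) : ℕ → S × S
  | 0 => (x, y)
  | n + 1 =>
    (sandwich (malcevPair x y w n).1 (w n) (malcevPair x y w n).2,
      sandwich (malcevPair x y w n).2 (w n) (malcevPair x y w n).1)

/-- `λ_n(x, y, w_1, …, w_n)`. -/
def malcevLam {S : Type*} [Semigroup S] (x y : S) (w : ℕ → WithOne S) (n : ℕ) : S :=
  (malcevPair x y w n).1

/-- `ρ_n(x, y, w_1, …, w_n)`. -/
def malcevRho {S : Type*} [Semigroup S] (x y : S) (w : ℕ → WithOne S) (n : ℕ) : S :=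
  (malcevPair x y w n).2

/-- Nilpotency of a semigroup in the sense of Mal'cev. -/
def IsMalcevNilpotent (S : Type*) [Semigroup S] : Prop :=
  ∃ n : ℕ, 0 < n ∧ ∀ (a b : S) (c : ℕ → WithOne S), malcevLam a b c n = malcevRho a b c n

theorem sandwich_comm {S : Type*} [Semigroup S] (hS : ∀ a b : S, a * b = b * a)
    (a b : S) (w : WithOne S) : sandwich a w b = sandwich b w a := by
  induction w using WithOne.recOneCoe with
  | one => exact hS a b
  | coe z =>
    change a * z * b = b * z * a
    rw [hS (a * z) b, hS a z, mul_assoc]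

/-- A commutative semigroup is nilpotent. -/
theorem isMalcevNilpotent_of_comm {S : Type*} [Semigroup S] (hS : ∀ a b : S, a * b = b * a) :
    IsMalcevNilpotent S :=
  ⟨1, Nat.one_pos, fun a b c => sandwich_comm hS a b (c 0)⟩

/-- The subsemigroup `⟨x⟩` is nilpotent. -/
theorem isMalcevNilpotent_closure_self {S : Type*} [Semigroup S] (x : S) :
    IsMalcevNilpotent (Subsemigroup.closure ({x, x} : Set S)) := by
  have h : ∀ a ∈ ({x, x} : Set S), ∀ b ∈ ({x, x} : Set S), a * b = b * a := by
    intro a ha b hb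
    simp only [Set.insert_eq_of_mem, Set.mem_singleton_iff] at ha hb
    rw [ha, hb]
  exact isMalcevNilpotent_of_comm (Subsemigroup.isMulCommutative_closure S h).is_comm.comm

/-- The upper non-nilpotent graph `𝒩_S`: the vertices are the elements of `S`, and `x`, `y` are
adjacent when the subsemigroup `⟨x, y⟩` is not nilpotent. -/
def upperNonNilpotentGraph (S : Type*) [Semigroup S] : SimpleGraph S where
  Adj x y := ¬ IsMalcevNilpotent (Subsemigroup.closure ({x, y} : Set S))
  symm := ⟨fun x y h => by rwa [Set.pair_comm y x]⟩
  loopless := ⟨fun x h => h (isMalcevNilpotent_closure_self x)⟩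

/-- A two-sided ideal of a semigroup; the empty set is allowed. -/
structure SgIdeal (S : Type*) [Semigroup S] where
  carrier : Set S
  mul_mem_left : ∀ (s : S) {a : S}, a ∈ carrier → s * a ∈ carrier
  mul_mem_right : ∀ (s : S) {a : S}, a ∈ carrier → a * s ∈ carrier

namespace SgIdeal

/-- An ideal, as a subsemigroup. -/
def toSubsemigroup {S : Type*} [Semigroup S] (I : SgIdeal S) : Subsemigroup S where
  carrier := I.carrier
  mul_mem' := fun {a _} _ hb => I.mul_mem_left a hb

/-- The ideal `I ∩ T` of a subsemigroup `T`. -/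
def restrict {S : Type*} [Semigroup S] (I : SgIdeal S) (T : Subsemigroup S) : SgIdeal T where
  carrier := {a | (a : S) ∈ I.carrier}
  mul_mem_left := fun s _ ha => I.mul_mem_left (s : S) ha
  mul_mem_right := fun s _ ha => I.mul_mem_right (s : S) ha

/-- The Rees congruence of an ideal; for the empty ideal it is equality. -/
def reesCon {S : Type*} [Semigroup S] (I : SgIdeal S) : Con S where
  r a b := a = b ∨ (a ∈ I.carrier ∧ b ∈ I.carrier)
  iseqv :=
    { refl := fun _ => Or.inl rfl
      symm := by
        rintro a b (h | ⟨h1, h2⟩)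
        · exact Or.inl h.symm
        · exact Or.inr ⟨h2, h1⟩
      trans := by
        rintro a b c (rfl | ⟨h1, h2⟩) (rfl | ⟨h3, h4⟩)
        · exact Or.inl rfl
        · exact Or.inr ⟨h3, h4⟩
        · exact Or.inr ⟨h1, h2⟩
        · exact Or.inr ⟨h1, h4⟩ }
  mul' := by
    rintro a b c d (rfl | ⟨h1, h2⟩) (rfl | ⟨h3, h4⟩)
    · exact Or.inl rfl
    · exact Or.inr ⟨I.mul_mem_left _ h3, I.mul_mem_left _ h4⟩
    · exact Or.inr ⟨I.mul_mem_right _ h1, I.mul_mem_right _ h2⟩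
    · exact Or.inr ⟨I.mul_mem_right _ h1, I.mul_mem_right _ h2⟩

/-- The Rees factor semigroup `S / I`; `S / ∅` is `S`. -/
abbrev ReesFactor {S : Type*} [Semigroup S] (I : SgIdeal S) : Type _ := I.reesCon.Quotient

/-- The class of an element in the Rees factor `S / I`. -/
def toFactor {S : Type*} [Semigroup S] (I : SgIdeal S) (a : S) : I.ReesFactor :=
  Con.toQuotient a

end SgIdeal

/-- The subsemigroup `⟨x, y, w_1, …, w_m⟩` of `S`, for `x, y ∈ S` and `w_1, …, w_m ∈ S¹` (an
adjoined identity among the `w_k` contributes no generator). -/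
def wordClosure {S : Type*} [Semigroup S] (x y : S) (w : ℕ → WithOne S) (m : ℕ) :
    Subsemigroup S :=
  Subsemigroup.closure ({x, y} ∪ {s | ∃ k < m, w k = (s : WithOne S)})

theorem sandwich_mem {S : Type*} [Semigroup S] (T : Subsemigroup S) {a b : S} {w : WithOne S}
    (ha : a ∈ T) (hb : b ∈ T) (hw : ∀ s : S, w = (s : WithOne S) → s ∈ T) :
    sandwich a w b ∈ T := by
  induction w using WithOne.recOneCoe with
  | one => exact T.mul_mem ha hb
  | coe z => exact T.mul_mem (T.mul_mem ha (hw z rfl)) hb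

theorem malcevPair_mem_wordClosure {S : Type*} [Semigroup S] (x y : S) (w : ℕ → WithOne S)
    (m : ℕ) : ∀ i ≤ m, malcevLam x y w i ∈ wordClosure x y w m ∧
      malcevRho x y w i ∈ wordClosure x y w m
  | 0, _ => ⟨Subsemigroup.subset_closure (Or.inl (Or.inl rfl)),
      Subsemigroup.subset_closure (Or.inl (Or.inr rfl))⟩
  | i + 1, hi => by
    obtain ⟨h1, h2⟩ := malcevPair_mem_wordClosure x y w m i (Nat.le_of_succ_le hi)
    have hw : ∀ s : S, w i = (s : WithOne S) → s ∈ wordClosure x y w m :=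
      fun s hs => Subsemigroup.subset_closure (Or.inr ⟨i, hi, hs⟩)
    exact ⟨sandwich_mem _ h1 h2 hw, sandwich_mem _ h2 h1 hw⟩

/-- `λ_i` as an element of `⟨x, y, w_1, …, w_m⟩`, for `i ≤ m`. -/
def lamIn {S : Type*} [Semigroup S] (x y : S) (w : ℕ → WithOne S) (m i : ℕ) (hi : i ≤ m) :
    wordClosure x y w m :=
  ⟨malcevLam x y w i, (malcevPair_mem_wordClosure x y w m i hi).1⟩

/-- `ρ_i` as an element of `⟨x, y, w_1, …, w_m⟩`, for `i ≤ m`. -/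
def rhoIn {S : Type*} [Semigroup S] (x y : S) (w : ℕ → WithOne S) (m i : ℕ) (hi : i ≤ m) :
    wordClosure x y w m :=
  ⟨malcevRho x y w i, (malcevPair_mem_wordClosure x y w m i hi).2⟩

/-- Pseudo-nilpotent semigroups. -/
def IsPseudoNilpotent (S : Type*) [Semigroup S] : Prop :=
  ∀ (x y : S) (w : ℕ → WithOne S) (t m : ℕ) (I : SgIdeal (wordClosure x y w m)),
    t < m →
    malcevLam x y w t ≠ malcevRho x y w t →
    malcevLam x y w t = malcevLam x y w m →
    malcevRho x y w t = malcevRho x y w m →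
    lamIn x y w m m le_rfl ∉ I.carrier →
    rhoIn x y w m m le_rfl ∉ I.carrier →
    ∀ (i : ℕ) (hi : i ≤ m),
      (upperNonNilpotentGraph I.ReesFactor).Adj
        (I.toFactor (lamIn x y w m i hi)) (I.toFactor (rhoIn x y w m i hi))

/-- A principal series `S = S_1 ⊃ S_2 ⊃ ⋯ ⊃ S_m ⊃ S_{m+1} = ∅` of ideals, with no ideal of `S`
strictly between two consecutive terms. The index is shifted by one: `S_{i+1}` is `term i`,
for `i = 0, …, m`. -/
structure PrincipalSeries (S : Type*) [Semigroup S] (m : ℕ) where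
  term : Fin (m + 1) → SgIdeal S
  term_zero : (term 0).carrier = Set.univ
  term_last : (term (Fin.last m)).carrier = ∅
  ssubset : ∀ i : Fin m, (term i.succ).carrier ⊂ (term i.castSucc).carrier
  no_between : ∀ (i : Fin m) (J : SgIdeal S),
    ¬ ((term i.succ).carrier ⊂ J.carrier ∧ J.carrier ⊂ (term i.castSucc).carrier)

namespace PrincipalSeries

/-- The set `S_i \ S_{i+1}`. -/
def layer {S : Type*} [Semigroup S] {m : ℕ} (P : PrincipalSeries S m) (i : Fin m) : Set S :=
  (P.term i.castSucc).carrier \ (P.term i.succ).carrier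

/-- The principal factor `S_i / S_{i+1}` is a nilpotent semigroup. -/
def FactorNilpotent {S : Type*} [Semigroup S] {m : ℕ} (P : PrincipalSeries S m) (i : Fin m) :
    Prop :=
  IsMalcevNilpotent
    ((P.term i.succ).restrict (P.term i.castSucc).toSubsemigroup).ReesFactor

/-- `F_{S_i / S_{i+1}}(S / S_{i+1})`: the elements `s` outside `S_i` such that `s j ≠ θ` or
`j s ≠ θ` in `S / S_{i+1}` for some `j ∈ S_i`. The nonzero elements of `S / S_{i+1}` are identified
with the elements of `S` outside `S_{i+1}`, so `≠ θ` means `∉ S_{i+1}`; when `S_{i+1} = ∅` this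
means that a zero has been adjoined. -/
def F {S : Type*} [Semigroup S] {m : ℕ} (P : PrincipalSeries S m) (i : Fin m) : Set S :=
  {s | s ∉ (P.term i.castSucc).carrier ∧
    ∃ j ∈ (P.term i.castSucc).carrier,
      s * j ∉ (P.term i.succ).carrier ∨ j * s ∉ (P.term i.succ).carrier}

/-- `S_i \ S_{i+1}` is a root. -/
def IsRoot {S : Type*} [Semigroup S] {m : ℕ} (P : PrincipalSeries S m) (i : Fin m) : Prop :=
  ¬ P.FactorNilpotent i ∧
    ∀ a ∈ P.layer i, ∀ b ∈ (P.term i.succ).carrier, ¬ (upperNonNilpotentGraph S).Adj a b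

/-- The index set `i^*`. -/
def starSet {S : Type*} [Semigroup S] {m : ℕ} (P : PrincipalSeries S m) (i : Fin m) :
    Set (Fin m) :=
  {j | j ≤ i ∧ P.layer j ⊆ P.F i ∪ P.layer i}

/-- The set `S^{(i)}`; it is called a stem when `S_i \ S_{i+1}` is a root. -/
def stem {S : Type*} [Semigroup S] {m : ℕ} (P : PrincipalSeries S m) (i : Fin m) : Set S :=
  ⋃ j ∈ P.starSet i, P.layer j

/-- `S_i \ S_{i+1}` is an isolated subset. -/
def IsIsolatedSubset {S : Type*} [Semigroup S] {m : ℕ} (P : PrincipalSeries S m) (i : Fin m) :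
    Prop :=
  ¬ P.IsRoot i ∧ ∀ j : Fin m, P.layer i ⊆ P.F j → P.FactorNilpotent j

/-- `K`, the union of all isolated subsets. -/
def K {S : Type*} [Semigroup S] {m : ℕ} (P : PrincipalSeries S m) : Set S :=
  ⋃ i ∈ {i | P.IsIsolatedSubset i}, P.layer i

/-- `S_j \ S_{j+1}` is a connection between the distinct stems `S^{(i₁)}` and `S^{(i₂)}`. -/
def IsConnection {S : Type*} [Semigroup S] {m : ℕ} (P : PrincipalSeries S m) (j i₁ i₂ : Fin m) :
    Prop :=
  P.IsRoot i₁ ∧ P.IsRoot i₂ ∧ P.stem i₁ ≠ P.stem i₂ ∧ P.layer j ⊆ P.stem i₁ ∩ P.stem i₂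

end PrincipalSeries

/-! A finite semigroup fails to be nilpotent exactly when the process (a, b) ↦ (awb, bwa) can return
to a pair of distinct elements, a loop. All pairs of a loop lie in one 𝒥-class. Pseudo-nilpotency
says: if the process started at (x, y), with any multipliers from S¹, reaches a loop outside an
ideal Z, then ⟨x, y⟩ already contains a loop outside Z (`IsPseudoNilpotent.exists_loop`).

From edges to structure. Two ℋ-related regular elements form no loop: translated into a maximal
subgroup they become a pair (1, g), which commutes. So a loop in a 𝒥-class J = A \ Z with
multipliers from A¹ forces two distinct ℒ- or ℛ-related idempotents e, f in J. Applying
pseudo-nilpotency to pairs (b, fb) and (a, af) then makes J closed under multiplication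
(`IsJClass.isWide_of_loop`). Such a J, a subsemigroup with at least two ℋ-classes, is called wide.
The wide layers are exactly those with non-nilpotent principal factor, and both ends of any edge act
on a common wide layer without leaving it.

From structure to edges. In a wide J one has ab ℛ a and ab ℒ b, so a pair that is not ℋ-related
stays so under multiplier 1 and must run into a loop. If s and t act on J and are not adjacent, then
set ℋ tes for e in J, hence se ℛ te and es ℒ et; any a in J outside that ℛ-class or outside that
ℒ-class is adjacent to both (`adj_or_exists_common_neighbour`).

For a wide layer, S^(i) is precisely the set of elements acting on it, a subsemigroup. The lowest
wide layer on which both ends of an edge act is a root, so every edge lies inside a stem. The four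
assertions follow: stems have diameter at most 2; if K is empty, the minimal ideal is a root on
which everything acts; without connections, distinct stems are disjoint, so no edge leaves a stem;
across a connection two paths of length 2 are joined. -/

open Relation

/-! ### Mal'cev steps, loops and nilpotency. -/

/-- One step `(a, b) ↦ (a w b, b w a)` of the Mal'cev process, with `w` taken from `W`. -/
def MalcevStep {S : Type*} [Semigroup S] (W : Set (WithOne S)) (p q : S × S) : Prop :=
  ∃ w ∈ W, q = (sandwich p.1 w p.2, sandwich p.2 w p.1)

/-- A pair of distinct elements to which the Mal'cev process can return. -/
def IsMalcevLoop {S : Type*} [Semigroup S] (W : Set (WithOne S)) (p : S × S) : Prop :=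
  TransGen (MalcevStep W) p p ∧ p.1 ≠ p.2

/-- `T¹` inside `S¹`, for a subsemigroup `T` of `S`. -/
def adjoinOne {S : Type*} [Semigroup S] (T : Subsemigroup S) : Set (WithOne S) :=
  {w | ∀ s : S, w = (s : WithOne S) → s ∈ T}

section Basic

variable {S : Type*} [Semigroup S]

theorem sandwich_one (a b : S) : sandwich a 1 b = a * b := rfl

theorem sandwich_coe (a z b : S) : sandwich a (z : WithOne S) b = a * z * b := rfl

theorem coe_sandwich (a : S) (w : WithOne S) (b : S) :
    ((sandwich a w b : S) : WithOne S) = a * w * b := by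
  induction w using WithOne.recOneCoe with
  | one => rw [sandwich_one, mul_one, WithOne.coe_mul]
  | coe z => rw [sandwich_coe, WithOne.coe_mul, WithOne.coe_mul]

theorem sandwich_mul_left (c a : S) (w : WithOne S) (b : S) :
    sandwich (c * a) w b = c * sandwich a w b := by
  rw [← WithOne.coe_inj]
  simp only [coe_sandwich, WithOne.coe_mul, mul_assoc]

theorem one_mem_adjoinOne (T : Subsemigroup S) : (1 : WithOne S) ∈ adjoinOne T :=
  fun _ hs => absurd hs WithOne.one_ne_coe

theorem coe_mem_adjoinOne {T : Subsemigroup S} {s : S} (hs : s ∈ T) :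
    (s : WithOne S) ∈ adjoinOne T :=
  fun _ ht => WithOne.coe_inj.1 ht ▸ hs

theorem adjoinOne_mono {T U : Subsemigroup S} (h : T ≤ U) : adjoinOne T ⊆ adjoinOne U :=
  fun _ hw s hs => h (hw s hs)

theorem malcevPair_succ (x y : S) (w : ℕ → WithOne S) (n : ℕ) :
    malcevPair x y w (n + 1) =
      (sandwich (malcevPair x y w n).1 (w n) (malcevPair x y w n).2,
        sandwich (malcevPair x y w n).2 (w n) (malcevPair x y w n).1) := rfl

theorem malcevPair_congr (x y : S) {w v : ℕ → WithOne S} :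
    ∀ {n : ℕ}, (∀ k < n, w k = v k) → malcevPair x y w n = malcevPair x y v n
  | 0, _ => rfl
  | n + 1, h => by
    rw [malcevPair_succ, malcevPair_succ, malcevPair_congr x y (n := n) fun k hk =>
      h k (Nat.lt_succ_of_lt hk), h n n.lt_succ_self]

theorem malcevPair_step (x y : S) (w : ℕ → WithOne S) (n : ℕ) :
    MalcevStep Set.univ (malcevPair x y w n) (malcevPair x y w (n + 1)) :=
  ⟨w n, trivial, rfl⟩

theorem malcevPair_update_le (x y : S) (w : ℕ → WithOne S) {n k : ℕ} (hk : k ≤ n)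
    (v : WithOne S) :
    malcevPair x y (Function.update w n v) k = malcevPair x y w k :=
  malcevPair_congr x y fun _ hj =>
    Function.update_of_ne (ne_of_lt (lt_of_lt_of_le hj hk)) _ _

theorem malcevPair_update_succ (x y : S) (w : ℕ → WithOne S) (n : ℕ) (v : WithOne S) :
    malcevPair x y (Function.update w n v) (n + 1) =
      (sandwich (malcevPair x y w n).1 v (malcevPair x y w n).2,
        sandwich (malcevPair x y w n).2 v (malcevPair x y w n).1) := by
  rw [malcevPair_succ, malcevPair_update_le x y w le_rfl, Function.update_self]

theorem malcevPair_transGen (x y : S) (w : ℕ → WithOne S) {t m : ℕ} (h : t < m) :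
    TransGen (MalcevStep Set.univ) (malcevPair x y w t) (malcevPair x y w m) := by
  induction m, h using Nat.le_induction with
  | base => exact .single (malcevPair_step x y w t)
  | succ m _ ih => exact ih.tail (malcevPair_step x y w m)

theorem exists_malcevPair_of_transGen {x y : S} {w : ℕ → WithOne S} {t : ℕ} {q : S × S}
    (h : TransGen (MalcevStep Set.univ) (malcevPair x y w t) q) :
    ∃ (v : ℕ → WithOne S) (m : ℕ), t < m ∧ malcevPair x y v t = malcevPair x y w t ∧
      malcevPair x y v m = q := by
  induction h with
  | single h =>
    obtain ⟨u, -, rfl⟩ := h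
    exact ⟨Function.update w t u, t + 1, t.lt_succ_self, malcevPair_update_le x y w le_rfl u,
      malcevPair_update_succ x y w t u⟩
  | tail _ h ih =>
    obtain ⟨u, -, rfl⟩ := h
    obtain ⟨v, m, htm, h1, rfl⟩ := ih
    exact ⟨Function.update v m u, m + 1, htm.trans m.lt_succ_self,
      (malcevPair_update_le x y v htm.le u).trans h1, malcevPair_update_succ x y v m u⟩

theorem exists_malcevPair_of_reflTransGen {p q : S × S}
    (h : ReflTransGen (MalcevStep Set.univ) p q) :
    ∃ (v : ℕ → WithOne S) (m : ℕ), malcevPair p.1 p.2 v m = q := by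
  rcases reflTransGen_iff_eq_or_transGen.1 h with rfl | h
  · exact ⟨1, 0, rfl⟩
  · obtain ⟨v, m, -, -, h2⟩ := exists_malcevPair_of_transGen (w := 1) (t := 0) h
    exact ⟨v, m, h2⟩

theorem MalcevStep.mono {W V : Set (WithOne S)} (h : W ⊆ V) {p q : S × S} :
    MalcevStep W p q → MalcevStep V p q :=
  fun ⟨w, hw, e⟩ => ⟨w, h hw, e⟩

theorem IsMalcevLoop.mono {W V : Set (WithOne S)} (h : W ⊆ V) {p : S × S}
    (hp : IsMalcevLoop W p) : IsMalcevLoop V p :=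
  ⟨TransGen.mono (fun _ _ => MalcevStep.mono h) _ _ hp.1, hp.2⟩

theorem MalcevStep.eq_of_eq {W : Set (WithOne S)} {p q : S × S} (h : MalcevStep W p q)
    (hp : p.1 = p.2) : q.1 = q.2 := by
  obtain ⟨w, -, rfl⟩ := h
  simp only [hp]

theorem reflTransGen_eq_of_eq {W : Set (WithOne S)} {p q : S × S}
    (h : ReflTransGen (MalcevStep W) p q) (hp : p.1 = p.2) : q.1 = q.2 := by
  induction h with
  | refl => exact hp
  | tail _ h ih => exact h.eq_of_eq ih

theorem IsMalcevLoop.exists_step {W : Set (WithOne S)} {p : S × S} (hp : IsMalcevLoop W p) :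
    ∃ q, MalcevStep W p q ∧ ReflTransGen (MalcevStep W) q p ∧ IsMalcevLoop W q := by
  obtain ⟨q, h1, h2⟩ := TransGen.head'_iff.1 hp.1
  exact ⟨q, h1, h2, TransGen.tail' h2 h1, fun hq => hp.2 (reflTransGen_eq_of_eq h2 hq)⟩

/-- A loop can be followed for any number of steps without the two entries ever coinciding. -/
theorem IsMalcevLoop.exists_malcevPair {p : S × S} (hp : IsMalcevLoop Set.univ p) (n : ℕ) :
    ∃ w : ℕ → WithOne S, IsMalcevLoop Set.univ (malcevPair p.1 p.2 w n) := by
  induction n with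
  | zero => exact ⟨1, hp⟩
  | succ n ih =>
    obtain ⟨w, hw⟩ := ih
    obtain ⟨q, ⟨u, -, rfl⟩, -, hq⟩ := hw.exists_step
    exact ⟨Function.update w n u, by rwa [malcevPair_update_succ]⟩

theorem not_isMalcevNilpotent_of_loop {p : S × S} (hp : IsMalcevLoop Set.univ p) :
    ¬ IsMalcevNilpotent S := by
  rintro ⟨n, -, h⟩
  obtain ⟨w, hw⟩ := hp.exists_malcevPair n
  exact hw.2 (h p.1 p.2 w)

/-- Pigeonhole on more than |S × S| successive pairs. Equal entries stay equal, so λ ≠ ρ at the end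
gives distinct entries at the repeated pair. -/
theorem exists_loop_of_not_isMalcevNilpotent [Finite S] (h : ¬ IsMalcevNilpotent S) :
    ∃ p : S × S, IsMalcevLoop Set.univ p := by
  simp only [IsMalcevNilpotent, not_exists, not_and, not_forall] at h
  obtain ⟨x, y, w, hne⟩ := h (Nat.card (S × S) + 1) (Nat.succ_pos _)
  have key : ∀ t m, t < m → m ≤ Nat.card (S × S) + 1 →
      malcevPair x y w t = malcevPair x y w m → ∃ p : S × S, IsMalcevLoop Set.univ p := by
    intro t m htm hm he
    refine ⟨malcevPair x y w t, ?_, fun h => hne ?_⟩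
    · have := malcevPair_transGen x y w htm
      rwa [← he] at this
    · exact reflTransGen_eq_of_eq
        (malcevPair_transGen x y w (lt_of_lt_of_le htm hm)).to_reflTransGen h
  have hni : ¬ Function.Injective
      fun k : Fin (Nat.card (S × S) + 2) => malcevPair x y w (k : ℕ) := by
    intro hinj
    have := Nat.card_le_card_of_injective _ hinj
    rw [Nat.card_fin] at this
    omega
  simp only [Function.Injective, not_forall] at hni
  obtain ⟨a, b, hab, hne'⟩ := hni
  have hne' : (a : ℕ) ≠ b := fun h => hne' (Fin.ext h)
  rcases lt_or_gt_of_ne hne' with h | h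
  · exact key a b h (by omega) hab
  · exact key b a h (by omega) hab.symm

/-- If an entry of a pair lies in an ideal, then so do the entries of the next pair. -/
theorem MalcevStep.mem_ideal {W : Set (WithOne S)} {p q : S × S} (h : MalcevStep W p q)
    (I : SgIdeal S) (hp : p.1 ∈ I.carrier ∨ p.2 ∈ I.carrier) :
    q.1 ∈ I.carrier ∧ q.2 ∈ I.carrier := by
  obtain ⟨w, -, rfl⟩ := h
  induction w using WithOne.recOneCoe with
  | one =>
    rcases hp with hp | hp
    · exact ⟨I.mul_mem_right _ hp, I.mul_mem_left _ hp⟩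
    · exact ⟨I.mul_mem_left _ hp, I.mul_mem_right _ hp⟩
  | coe z =>
    rcases hp with hp | hp
    · exact ⟨I.mul_mem_right _ (I.mul_mem_right _ hp), I.mul_mem_left _ hp⟩
    · exact ⟨I.mul_mem_left _ hp, I.mul_mem_right _ (I.mul_mem_right _ hp)⟩

theorem reflTransGen_mem_ideal {W : Set (WithOne S)} {p q : S × S}
    (h : ReflTransGen (MalcevStep W) p q) (I : SgIdeal S)
    (hp : p.1 ∈ I.carrier ∧ p.2 ∈ I.carrier) : q.1 ∈ I.carrier ∧ q.2 ∈ I.carrier := by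
  induction h with
  | refl => exact hp
  | tail _ h ih => exact h.mem_ideal I (Or.inl ih.1)

theorem IsMalcevLoop.mem_ideal {W : Set (WithOne S)} {p : S × S} (h : IsMalcevLoop W p)
    (I : SgIdeal S) (hp : p.1 ∈ I.carrier ∨ p.2 ∈ I.carrier) :
    p.1 ∈ I.carrier ∧ p.2 ∈ I.carrier := by
  obtain ⟨q, h1, h2, -⟩ := h.exists_step
  exact reflTransGen_mem_ideal h2 I (h1.mem_ideal I hp)

end Basic

/-! ### Transport of loops along homomorphisms. -/

section Hom

variable {A B : Type*} [Semigroup A] [Semigroup B] (f : A →ₙ* B)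

theorem map_sandwich (a : A) (w : WithOne A) (b : A) :
    f (sandwich a w b) = sandwich (f a) (WithOne.mapMulHom f w) (f b) := by
  induction w using WithOne.recOneCoe with
  | one => exact map_mul f a b
  | coe z => rw [sandwich_coe, WithOne.mapMulHom_coe, sandwich_coe, map_mul, map_mul]

theorem MalcevStep.map {W : Set (WithOne A)} {V : Set (WithOne B)}
    (h : Set.MapsTo (WithOne.mapMulHom f) W V) {p q : A × A} (hpq : MalcevStep W p q) :
    MalcevStep V (f p.1, f p.2) (f q.1, f q.2) := by
  obtain ⟨w, hw, rfl⟩ := hpq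
  exact ⟨_, h hw, by simp only [map_sandwich]⟩

theorem transGen_map {W : Set (WithOne A)} {V : Set (WithOne B)}
    (h : Set.MapsTo (WithOne.mapMulHom f) W V) {p q : A × A}
    (hpq : TransGen (MalcevStep W) p q) :
    TransGen (MalcevStep V) (f p.1, f p.2) (f q.1, f q.2) :=
  hpq.lift (fun p : A × A => (f p.1, f p.2)) fun _ _ => MalcevStep.map f h

/-- Only the start and the multipliers are lifted, so a lifted loop ends at some pair over the
start, not necessarily at the start itself. -/
theorem transGen_lift {W : Set (WithOne A)} {V : Set (WithOne B)}
    (h : Set.SurjOn (WithOne.mapMulHom f) W V) {p : A × A} {q : B × B}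
    (hpq : TransGen (MalcevStep V) (f p.1, f p.2) q) :
    ∃ r : A × A, (f r.1, f r.2) = q ∧ TransGen (MalcevStep W) p r := by
  induction hpq with
  | single hs =>
    obtain ⟨v, hv, rfl⟩ := hs
    obtain ⟨w, hw, rfl⟩ := h hv
    exact ⟨_, by simp only [map_sandwich], .single ⟨w, hw, rfl⟩⟩
  | tail _ hs ih =>
    obtain ⟨v, hv, rfl⟩ := hs
    obtain ⟨w, hw, rfl⟩ := h hv
    obtain ⟨r, rfl, hr⟩ := ih
    exact ⟨_, by simp only [map_sandwich], hr.tail ⟨w, hw, rfl⟩⟩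

theorem mapsTo_adjoinOne_map (T : Subsemigroup A) :
    Set.MapsTo (WithOne.mapMulHom f) (adjoinOne T) (adjoinOne (T.map f)) := by
  intro w hw
  induction w using WithOne.recOneCoe with
  | one => exact one_mem_adjoinOne _
  | coe z => exact coe_mem_adjoinOne ⟨z, hw z rfl, rfl⟩

theorem surjOn_adjoinOne_map (T : Subsemigroup A) :
    Set.SurjOn (WithOne.mapMulHom f) (adjoinOne T) (adjoinOne (T.map f)) := by
  intro v hv
  induction v using WithOne.recOneCoe with
  | one => exact ⟨1, one_mem_adjoinOne _, map_one _⟩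
  | coe z =>
    obtain ⟨a, ha, rfl⟩ := hv z rfl
    exact ⟨a, coe_mem_adjoinOne ha, rfl⟩

theorem IsMalcevLoop.map_of_injective (hf : Function.Injective f) {T : Subsemigroup A}
    {p : A × A} (hp : IsMalcevLoop (adjoinOne T) p) :
    IsMalcevLoop (adjoinOne (T.map f)) (f p.1, f p.2) :=
  ⟨transGen_map f (mapsTo_adjoinOne_map f T) hp.1, fun h => hp.2 (hf h)⟩

theorem adjoinOne_top {S : Type*} [Semigroup S] :
    adjoinOne (⊤ : Subsemigroup S) = Set.univ :=
  Set.eq_univ_of_forall fun _ _ _ => trivial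

theorem Subsemigroup.map_subtype_top {S : Type*} [Semigroup S] (T : Subsemigroup S) :
    (⊤ : Subsemigroup T).map (MulMemClass.subtype T) = T := by
  ext s
  constructor
  · rintro ⟨a, -, rfl⟩
    exact a.2
  · exact fun hs => ⟨⟨s, hs⟩, trivial, rfl⟩

/-- A subsemigroup `T` of a finite semigroup is not nilpotent if and only if it has a loop. -/
theorem not_isMalcevNilpotent_subsemigroup_iff {S : Type*} [Semigroup S] [Finite S]
    (T : Subsemigroup S) :
    ¬ IsMalcevNilpotent T ↔
      ∃ p : S × S, p.1 ∈ T ∧ p.2 ∈ T ∧ IsMalcevLoop (adjoinOne T) p := by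
  constructor
  · intro h
    obtain ⟨p, hp⟩ := exists_loop_of_not_isMalcevNilpotent h
    rw [← adjoinOne_top] at hp
    have := hp.map_of_injective (MulMemClass.subtype T) Subtype.val_injective
    rw [Subsemigroup.map_subtype_top] at this
    exact ⟨_, p.1.2, p.2.2, this⟩
  · rintro ⟨p, h1, h2, hp, hne⟩
    have hs := surjOn_adjoinOne_map (MulMemClass.subtype T) ⊤
    rw [Subsemigroup.map_subtype_top] at hs
    obtain ⟨r, hr, hpr⟩ := transGen_lift (MulMemClass.subtype T)
      (p := ((⟨p.1, h1⟩, ⟨p.2, h2⟩) : T × T)) hs hp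
    have he : r = (⟨p.1, h1⟩, ⟨p.2, h2⟩) :=
      Prod.ext (Subtype.ext (congrArg Prod.fst hr)) (Subtype.ext (congrArg Prod.snd hr))
    subst he
    rw [adjoinOne_top] at hpr
    exact not_isMalcevNilpotent_of_loop ⟨hpr, fun h => hne (congrArg Subtype.val h)⟩

theorem adj_iff_exists_loop {S : Type*} [Semigroup S] [Finite S] {x y : S} :
    (upperNonNilpotentGraph S).Adj x y ↔
      ∃ p : S × S, p.1 ∈ Subsemigroup.closure {x, y} ∧ p.2 ∈ Subsemigroup.closure {x, y} ∧
        IsMalcevLoop (adjoinOne (Subsemigroup.closure {x, y})) p :=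
  not_isMalcevNilpotent_subsemigroup_iff _

end Hom

/-! ### Loops in Rees factors. -/

section Rees

variable {U : Type*} [Semigroup U] (I : SgIdeal U)

theorem toFactor_eq_iff {a b : U} :
    I.toFactor a = I.toFactor b ↔ a = b ∨ (a ∈ I.carrier ∧ b ∈ I.carrier) :=
  Con.eq I.reesCon

/-- The projection onto the Rees factor. -/
def toFactorHom : U →ₙ* I.ReesFactor := I.reesCon.mkMulHom

/-- A loop of a Rees factor lifts to a loop outside the ideal. -/
theorem exists_loop_of_loop_factor {C : Subsemigroup U} {q : I.ReesFactor × I.ReesFactor}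
    (h1 : q.1 ∈ C.map (toFactorHom I)) (h2 : q.2 ∈ C.map (toFactorHom I))
    (hq : IsMalcevLoop (adjoinOne (C.map (toFactorHom I))) q) :
    ∃ p : U × U, p.1 ∈ C ∧ p.2 ∈ C ∧ p.1 ∉ I.carrier ∧ p.2 ∉ I.carrier ∧
      IsMalcevLoop (adjoinOne C) p := by
  obtain ⟨q1, q2⟩ := q
  obtain ⟨a, ha, rfl⟩ := h1
  obtain ⟨b, hb, rfl⟩ := h2
  obtain ⟨hq, hne⟩ := hq
  obtain ⟨r, hr, hp⟩ := transGen_lift (toFactorHom I) (p := (a, b))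
    (surjOn_adjoinOne_map (toFactorHom I) C) hq
  have hr1 := (toFactor_eq_iff I).1 (congrArg Prod.fst hr)
  have hr2 := (toFactor_eq_iff I).1 (congrArg Prod.snd hr)
  -- An entry in I would push all later pairs into I, and both entries of the loop would be the zero
  -- of the factor. Outside I the projection is injective, so the lifted process closes up.
  have hmem : ¬ (a ∈ I.carrier ∨ b ∈ I.carrier) := by
    intro h
    obtain ⟨s, hs, hs'⟩ := TransGen.head'_iff.1 hp
    have hrI := reflTransGen_mem_ideal hs' I (hs.mem_ideal I h)
    refine hne ((toFactor_eq_iff I).2 (Or.inr ⟨?_, ?_⟩))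
    · rcases hr1 with h | h
      · exact h ▸ hrI.1
      · exact h.2
    · rcases hr2 with h | h
      · exact h ▸ hrI.2
      · exact h.2
  rw [not_or] at hmem
  have h1 : r.1 = a := hr1.resolve_right fun h => hmem.1 h.2
  have h2 : r.2 = b := hr2.resolve_right fun h => hmem.2 h.2
  have hrab : r = (a, b) := Prod.ext h1 h2
  rw [hrab] at hp
  exact ⟨(a, b), ha, hb, hmem.1, hmem.2, hp,
    fun h => hne (congrArg (toFactorHom I) (h : a = b))⟩

end Rees

/-! ### Pseudo-nilpotency expressed through loops. -/

/-- The local information contained in pseudo-nilpotency: if the Mal'cev process leads from `p`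
to a loop outside the ideal `Z`, then the subsemigroup generated by the entries of `p` has
a loop outside `Z`. -/
theorem IsPseudoNilpotent.exists_loop {S : Type*} [Semigroup S] [Finite S]
    (hS : IsPseudoNilpotent S) {p q : S × S} (hpq : ReflTransGen (MalcevStep Set.univ) p q)
    (hq : IsMalcevLoop Set.univ q) (Z : SgIdeal S) (h1 : q.1 ∉ Z.carrier) (h2 : q.2 ∉ Z.carrier) :
    ∃ r : S × S, r.1 ∈ Subsemigroup.closure {p.1, p.2} ∧ r.2 ∈ Subsemigroup.closure {p.1, p.2} ∧
      r.1 ∉ Z.carrier ∧ r.2 ∉ Z.carrier ∧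
      IsMalcevLoop (adjoinOne (Subsemigroup.closure {p.1, p.2})) r := by
  obtain ⟨v, t, rfl⟩ := exists_malcevPair_of_reflTransGen hpq
  obtain ⟨w, m, htm, hwt, hwm⟩ := exists_malcevPair_of_transGen hq.1
  rw [← hwt] at hwm h1 h2
  have hne : (malcevPair p.1 p.2 w t).1 ≠ (malcevPair p.1 p.2 w t).2 := by
    rw [hwt]
    exact hq.2
  set U := wordClosure p.1 p.2 w m with hU
  -- Index 0 is taken, so that the edge joins the entries of p themselves.
  have hadj := hS p.1 p.2 w t m (Z.restrict U) htm hne (congrArg Prod.fst hwm.symm)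
    (congrArg Prod.snd hwm.symm)
    (by change (malcevPair p.1 p.2 w m).1 ∉ Z.carrier; rwa [hwm])
    (by change (malcevPair p.1 p.2 w m).2 ∉ Z.carrier; rwa [hwm]) 0 (Nat.zero_le _)
  set x := lamIn p.1 p.2 w m 0 (Nat.zero_le _)
  set y := rhoIn p.1 p.2 w m 0 (Nat.zero_le _)
  have : Finite (Z.restrict U).ReesFactor :=
    Finite.of_surjective (Z.restrict U).toFactor Quot.mk_surjective
  obtain ⟨q', hq1, hq2, hq'⟩ := adj_iff_exists_loop.1 hadj
  have hc : (Subsemigroup.closure {x, y}).map (toFactorHom (Z.restrict U)) =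
      Subsemigroup.closure {(Z.restrict U).toFactor x, (Z.restrict U).toFactor y} := by
    rw [MulHom.map_mclosure, Set.image_pair]
    rfl
  rw [← hc] at hq1 hq2 hq'
  obtain ⟨r, hr1, hr2, hr3, hr4, hr⟩ := exists_loop_of_loop_factor _ hq1 hq2 hq'
  have hr' := hr.map_of_injective (MulMemClass.subtype U) Subtype.val_injective
  have hc' : (Subsemigroup.closure {x, y}).map (MulMemClass.subtype U) =
      Subsemigroup.closure {p.1, p.2} := by
    rw [MulHom.map_mclosure, Set.image_pair]
    rfl
  rw [hc'] at hr'
  exact ⟨(r.1, r.2), hc' ▸ ⟨r.1, hr1, rfl⟩, hc' ▸ ⟨r.2, hr2, rfl⟩, hr3, hr4, hr'⟩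

/-- The empty ideal. -/
def emptyIdeal (S : Type*) [Semigroup S] : SgIdeal S where
  carrier := ∅
  mul_mem_left _ _ h := h.elim
  mul_mem_right _ _ h := h.elim

/-- The set `A \ Z` is contained in a single `𝒥`-class. -/
def IsJClass {S : Type*} [Semigroup S] (A Z : SgIdeal S) : Prop :=
  ∀ a ∈ A.carrier \ Z.carrier, ∀ b ∈ A.carrier \ Z.carrier,
    ∃ c d : WithOne S, (b : WithOne S) = c * a * d

/-- The set `A \ Z` is a subsemigroup with at least two `ℋ`-classes. -/
def IsWide {S : Type*} [Semigroup S] (A Z : SgIdeal S) : Prop :=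
  (∀ a ∈ A.carrier \ Z.carrier, ∀ b ∈ A.carrier \ Z.carrier, a * b ∈ A.carrier \ Z.carrier) ∧
    ∃ a ∈ A.carrier \ Z.carrier, ∃ b ∈ A.carrier \ Z.carrier,
      (∀ s, b ≠ a * s) ∨ (∀ s, b ≠ s * a)

section Adjacency

variable {S : Type*} [Semigroup S] [Finite S]

theorem IsPseudoNilpotent.adj (hS : IsPseudoNilpotent S) {p q : S × S}
    (hpq : ReflTransGen (MalcevStep Set.univ) p q) (hq : IsMalcevLoop Set.univ q) :
    (upperNonNilpotentGraph S).Adj p.1 p.2 := by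
  obtain ⟨r, h1, h2, -, -, h3⟩ := hS.exists_loop hpq hq (emptyIdeal S) id id
  exact adj_iff_exists_loop.2 ⟨r, h1, h2, h3⟩

theorem not_adj_of_commute {S : Type*} [Semigroup S] {x y : S} (h : x * y = y * x) :
    ¬ (upperNonNilpotentGraph S).Adj x y := by
  have hc : ∀ a ∈ ({x, y} : Set S), ∀ b ∈ ({x, y} : Set S), a * b = b * a := by
    rintro a (rfl | rfl) b (rfl | rfl)
    exacts [rfl, h, h.symm, rfl]
  exact fun hadj => hadj
    (isMalcevNilpotent_of_comm (Subsemigroup.isMulCommutative_closure S hc).is_comm.comm)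

/-- A pseudo-nilpotent semigroup has no loop consisting of `ℋ`-related regular elements. -/
theorem IsPseudoNilpotent.not_loop_of_regular (hS : IsPseudoNilpotent S) {p : S × S}
    {a b c : S} (ha : p.2 = p.1 * a) (hb : p.2 = b * p.1) (hc : p.1 * c * p.1 = p.1) :
    ¬ IsMalcevLoop Set.univ p := by
  intro hp
  obtain ⟨x, y⟩ := p
  simp only at ha hb hc
  -- x' is an inverse of x, hence x'x is idempotent and x'y lies in its ℋ-class.
  set x' := c * x * c with hx'
  have h1 : x * x' * x = x := by
    rw [hx', ← mul_assoc, ← mul_assoc, hc, hc]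
  have h2 : x' * x * x' = x' := by clear ha hb hp; grind
  -- Since v = xx'v along the process, x'(uwv) = (x'u)(wx)(x'v): left translation by x' carries
  -- steps to steps, with multiplier w replaced by wx.
  have key : ∀ {q r : S × S}, x * (x' * q.1) = q.1 → x * (x' * q.2) = q.2 →
      MalcevStep Set.univ q r → MalcevStep Set.univ (x' * q.1, x' * q.2) (x' * r.1, x' * r.2) ∧
        x * (x' * r.1) = r.1 ∧ x * (x' * r.2) = r.2 := by
    rintro ⟨u, v⟩ r hu hv ⟨w, -, rfl⟩
    simp only at hu hv
    have hs : ∀ {u v : S}, x * (x' * v) = v →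
        x' * sandwich u w v = sandwich (x' * u) (w * (x : WithOne S)) (x' * v) := by
      intro u v hv
      rw [sandwich_mul_left]
      congr 1
      rw [← WithOne.coe_inj, coe_sandwich, coe_sandwich]
      nth_rewrite 1 [← hv]
      simp only [WithOne.coe_mul, mul_assoc]
    refine ⟨⟨w * (x : WithOne S), trivial, by simp only [hs hu, hs hv]⟩, ?_, ?_⟩
    · rw [← sandwich_mul_left, ← sandwich_mul_left, hu]
    · rw [← sandwich_mul_left, ← sandwich_mul_left, hv]
  have hx : x * (x' * x) = x := by rw [← mul_assoc, h1]
  have hy : x * (x' * y) = y := by rw [ha, ← mul_assoc x', ← mul_assoc x, ← mul_assoc x, h1]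
  have hpath : ∀ {r : S × S}, TransGen (MalcevStep Set.univ) (x, y) r →
      TransGen (MalcevStep Set.univ) (x' * x, x' * y) (x' * r.1, x' * r.2) ∧
        x * (x' * r.1) = r.1 ∧ x * (x' * r.2) = r.2 := by
    intro r hr
    induction hr with
    | single h =>
      obtain ⟨h3, h4⟩ := key hx hy h
      exact ⟨.single h3, h4⟩
    | tail _ h ih =>
      obtain ⟨h3, h4⟩ := key ih.2.1 ih.2.2 h
      exact ⟨ih.1.tail h3, h4⟩
  have hloop : IsMalcevLoop Set.univ (x' * x, x' * y) :=
    ⟨(hpath hp.1).1, fun h : x' * x = x' * y => hp.2 (by rw [← hx, ← hy, h])⟩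
  -- x'x is a two-sided identity for x'y, so the translated pair commutes although it is a loop.
  refine not_adj_of_commute ?_ (hS.adj .refl hloop)
  change x' * x * (x' * y) = x' * y * (x' * x)
  rw [← mul_assoc, h2, hb]
  simp only [mul_assoc]
  rw [hx]

end Adjacency

/-! ### Stability and idempotents in a 𝒥-class. -/

section JClass

variable {S : Type*} [Semigroup S] {A Z : SgIdeal S}

theorem left_mem_diff {a b : S} (ha : a ∈ A.carrier) (h : a * b ∉ Z.carrier) :
    a ∈ A.carrier \ Z.carrier :=
  ⟨ha, fun h' => h (Z.mul_mem_right _ h')⟩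

theorem right_mem_diff {a b : S} (hb : b ∈ A.carrier) (h : a * b ∉ Z.carrier) :
    b ∈ A.carrier \ Z.carrier :=
  ⟨hb, fun h' => h (Z.mul_mem_left _ h')⟩

/-- Iterating gives x = aⁿxcⁿ; two exponents with the same pair (aⁿ, cⁿ) let the surplus power be
absorbed on either side. -/
theorem exists_pow_stable {M : Type*} [Monoid M] [Finite M] {a x c : M} (h : x = a * x * c) :
    ∃ k : ℕ, x = x * c ^ (k + 1) ∧ x = a ^ (k + 1) * x := by
  have hn : ∀ n : ℕ, x = a ^ n * x * c ^ n := by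
    intro n
    induction n with
    | zero => simp
    | succ n ih =>
      calc x = a ^ n * x * c ^ n := ih
        _ = a ^ n * (a * x * c) * c ^ n := by rw [← h]
        _ = a ^ (n + 1) * x * c ^ (n + 1) := by
          rw [pow_succ a, pow_succ' c]
          simp only [mul_assoc]
  have hni : ¬ Function.Injective fun n : ℕ => ((a ^ n, c ^ n) : M × M) :=
    not_injective_infinite_finite _
  simp only [Function.Injective, not_forall] at hni
  obtain ⟨n, m, hnm, hne⟩ := hni
  have key : ∀ n m : ℕ, n < m → a ^ n = a ^ m → c ^ n = c ^ m →
      ∃ k : ℕ, x = x * c ^ (k + 1) ∧ x = a ^ (k + 1) * x := by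
    intro n m hlt h1 h2
    obtain ⟨k, rfl⟩ := Nat.exists_eq_add_of_lt hlt
    refine ⟨k, ?_, ?_⟩
    · calc x = a ^ n * x * c ^ n := hn n
        _ = a ^ n * x * c ^ n * c ^ (k + 1) := by
          rw [mul_assoc _ (c ^ n), ← pow_add, ← add_assoc, ← h2]
        _ = x * c ^ (k + 1) := by rw [← hn n]
    · calc x = a ^ n * x * c ^ n := hn n
        _ = a ^ (k + 1) * (a ^ n * x * c ^ n) := by
          rw [← mul_assoc, ← mul_assoc, ← pow_add, add_comm (k + 1), ← add_assoc, ← h1]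
        _ = a ^ (k + 1) * x := by rw [← hn n]
  rcases lt_or_gt_of_ne hne with hlt | hlt
  · exact key n m hlt (congrArg Prod.fst hnm) (congrArg Prod.snd hnm)
  · exact key m n hlt (congrArg Prod.fst hnm).symm (congrArg Prod.snd hnm).symm

theorem exists_coe_eq_coe_mul (b : S) (w : WithOne S) :
    ∃ s : S, (s : WithOne S) = b * w := by
  induction w using WithOne.recOneCoe with
  | one => exact ⟨b, (mul_one _).symm⟩
  | coe z => exact ⟨b * z, WithOne.coe_mul _ _⟩

theorem exists_coe_eq_mul_coe (b : S) (w : WithOne S) :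
    ∃ s : S, (s : WithOne S) = w * b := by
  induction w using WithOne.recOneCoe with
  | one => exact ⟨b, (one_mul _).symm⟩
  | coe z => exact ⟨z * b, WithOne.coe_mul _ _⟩

namespace IsJClass

/-- Green's stability: a product that stays in the 𝒥-class is ℛ-related to its left factor and
ℒ-related to its right factor. -/
theorem stable [Finite S] (hJ : IsJClass A Z) {x y : S} (h : x * y ∈ A.carrier \ Z.carrier) :
    (x ∈ A.carrier → ∃ c, x = x * y * c) ∧ (y ∈ A.carrier → ∃ c, y = c * (x * y)) := by
  have : Finite (WithOne S) := inferInstanceAs (Finite (Option S))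
  constructor
  · intro hx
    obtain ⟨a, b, hab⟩ := hJ (x * y) h x (left_mem_diff hx h.2)
    have h1 : (x : WithOne S) = a * x * (y * b) := by
      rw [WithOne.coe_mul] at hab
      simpa only [mul_assoc] using hab
    obtain ⟨k, hk, -⟩ := exists_pow_stable h1
    obtain ⟨s, hs⟩ := exists_coe_eq_coe_mul y (b * (y * b) ^ k)
    have h2 : x = x * s := by
      rw [← WithOne.coe_inj, WithOne.coe_mul, hs]
      rwa [pow_succ', mul_assoc (y : WithOne S)] at hk
    -- Using x = xs twice puts the cofactor in S rather than S¹.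
    obtain ⟨t, ht⟩ := exists_coe_eq_mul_coe s (b * (y * b) ^ k)
    refine ⟨t, ?_⟩
    rw [← WithOne.coe_inj]
    calc (x : WithOne S) = x * s * s := by rw [← WithOne.coe_mul, ← h2, ← WithOne.coe_mul, ← h2]
      _ = x * (y * (b * (y * b) ^ k)) * s := by rw [hs]
      _ = ((x * y * t : S) : WithOne S) := by
        rw [WithOne.coe_mul, WithOne.coe_mul, ht]
        simp only [mul_assoc]
  · intro hy
    obtain ⟨a, b, hab⟩ := hJ (x * y) h y (right_mem_diff hy h.2)
    have h1 : (y : WithOne S) = a * x * y * b := by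
      rw [WithOne.coe_mul] at hab
      simpa only [mul_assoc] using hab
    obtain ⟨k, -, hk⟩ := exists_pow_stable h1
    obtain ⟨s, hs⟩ := exists_coe_eq_mul_coe x ((a * x) ^ k * a)
    have h2 : y = s * y := by
      rw [← WithOne.coe_inj, WithOne.coe_mul, hs]
      rwa [pow_succ, ← mul_assoc] at hk
    obtain ⟨t, ht⟩ := exists_coe_eq_coe_mul s ((a * x) ^ k * a)
    refine ⟨t, ?_⟩
    rw [← WithOne.coe_inj]
    calc (y : WithOne S) = s * (s * y) := by rw [← WithOne.coe_mul, ← h2, ← WithOne.coe_mul, ← h2]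
      _ = s * ((a * x) ^ k * a * x * y) := by rw [hs]
      _ = ((t * (x * y) : S) : WithOne S) := by
        rw [WithOne.coe_mul, WithOne.coe_mul, ht]
        simp only [mul_assoc]

/-- An element factors through an idempotent of its `𝒥`-class. -/
theorem exists_factor (hJ : IsJClass A Z) {c e : S} (hc : c ∈ A.carrier \ Z.carrier)
    (he : e ∈ A.carrier \ Z.carrier) (hee : e * e = e) :
    ∃ a b, a ∈ A.carrier \ Z.carrier ∧ b ∈ A.carrier \ Z.carrier ∧ a * b = c ∧
      a * e = a ∧ e * b = b := by
  obtain ⟨u, v, huv⟩ := hJ e he c hc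
  obtain ⟨a, ha⟩ := exists_coe_eq_mul_coe e u
  obtain ⟨b, hb⟩ := exists_coe_eq_coe_mul e v
  have hee' : (e : WithOne S) * e = e := by rw [← WithOne.coe_mul, hee]
  have hae : a * e = a := by rw [← WithOne.coe_inj, WithOne.coe_mul, ha, mul_assoc, hee']
  have heb : e * b = b := by rw [← WithOne.coe_inj, WithOne.coe_mul, hb, ← mul_assoc, hee']
  have hab : a * b = c := by
    rw [← WithOne.coe_inj, WithOne.coe_mul, ha, hb, huv, mul_assoc, ← mul_assoc (e : WithOne S),
      hee', mul_assoc]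
  rw [← hab] at hc
  exact ⟨a, b, left_mem_diff (hae ▸ A.mul_mem_left _ he.1) hc.2,
    right_mem_diff (heb ▸ A.mul_mem_right _ he.1) hc.2, hab, hae, heb⟩

variable [Finite S]

theorem stable_right (hJ : IsJClass A Z) {x y : S} (hx : x ∈ A.carrier)
    (hxy : x * y ∉ Z.carrier) : ∃ c, x = x * y * c :=
  (hJ.stable ⟨A.mul_mem_right _ hx, hxy⟩).1 hx

theorem stable_left (hJ : IsJClass A Z) {x y : S} (hy : y ∈ A.carrier)
    (hxy : x * y ∉ Z.carrier) : ∃ c, y = c * (x * y) :=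
  (hJ.stable ⟨A.mul_mem_left _ hy, hxy⟩).2 hy

/-- By stability b is a left multiple of ab, so bc is a left multiple of abc. -/
theorem mul_mul_notMem (hJ : IsJClass A Z) {a b c : S} (hb : b ∈ A.carrier)
    (hab : a * b ∉ Z.carrier) (hbc : b * c ∉ Z.carrier) : a * b * c ∉ Z.carrier := by
  obtain ⟨d, hd⟩ := hJ.stable_left hb hab
  intro h
  apply hbc
  rw [hd, mul_assoc]
  exact Z.mul_mem_left _ h

/-- From z = zxc and x = dzx one gets xc = dzxc = dz, an idempotent in the ℛ-class of x and the
ℒ-class of z. -/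
theorem regular_of_mul_notMem (hJ : IsJClass A Z) {z x : S} (hz : z ∈ A.carrier)
    (hx : x ∈ A.carrier) (hzx : z * x ∉ Z.carrier) :
    ∃ c d, x * c * x = x ∧ z * (x * c) = z ∧ x * c = d * z := by
  obtain ⟨c, hc⟩ := hJ.stable_right hz hzx
  obtain ⟨d, hd⟩ := hJ.stable_left hx hzx
  have h1 : d * z * x * c = x * c := by rw [mul_assoc d, ← hd]
  have h2 : d * z * x * c = d * z := by rw [mul_assoc d, mul_assoc d, ← hc]
  refine ⟨c, d, ?_, by rw [← mul_assoc, ← hc], by rw [← h1, h2]⟩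
  rw [← h1, h2, mul_assoc, ← hd]

/-- Two elements that are not `ℛ`-related and that can be multiplied on the left by the same
element yield two distinct `ℒ`-related idempotents. -/
theorem exists_left_pair (hJ : IsJClass A Z) {z x y : S} (hz : z ∈ A.carrier) (hx : x ∈ A.carrier)
    (hy : y ∈ A.carrier) (hzx : z * x ∉ Z.carrier) (hzy : z * y ∉ Z.carrier)
    (hxy : ∀ s, y ≠ x * s) :
    ∃ e f g, e ∈ A.carrier \ Z.carrier ∧ f ∈ A.carrier \ Z.carrier ∧ e * f = e ∧ f * e = f ∧
      e ≠ f ∧ e = x * g := by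
  obtain ⟨c, d, h1, h2, h3⟩ := hJ.regular_of_mul_notMem hz hx hzx
  obtain ⟨c', d', h1', h2', h3'⟩ := hJ.regular_of_mul_notMem hz hy hzy
  have hzZ := (left_mem_diff hz hzx).2
  refine ⟨x * c, y * c', c, right_mem_diff (a := z) (A.mul_mem_right _ hx) (h2.symm ▸ hzZ),
    right_mem_diff (a := z) (A.mul_mem_right _ hy) (h2'.symm ▸ hzZ), ?_, ?_, ?_, rfl⟩
  · rw [h3, mul_assoc, h2']
  · rw [h3', mul_assoc, h2]
  · intro h
    exact hxy (c * y) (by rw [← mul_assoc, h, h1'])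

theorem exists_right_pair (hJ : IsJClass A Z) {z x y : S} (hz : z ∈ A.carrier)
    (hx : x ∈ A.carrier) (hy : y ∈ A.carrier) (hxz : x * z ∉ Z.carrier) (hyz : y * z ∉ Z.carrier)
    (hxy : ∀ s, y ≠ s * x) :
    ∃ e f g, e ∈ A.carrier \ Z.carrier ∧ f ∈ A.carrier \ Z.carrier ∧ e * f = f ∧ f * e = e ∧
      e ≠ f ∧ e = g * x := by
  have key : ∀ {u : S}, u ∈ A.carrier → u * z ∉ Z.carrier →
      ∃ c d, c * u * z = z ∧ c * u = z * d ∧ u * (z * d) = u := by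
    intro u hu huz
    obtain ⟨c, hc⟩ := hJ.stable_left hz huz
    obtain ⟨d, hd⟩ := hJ.stable_right hu huz
    have h1 : c * u * z * d = z * d := by rw [mul_assoc c, ← hc]
    have h2 : c * u * z * d = c * u := by rw [mul_assoc c, mul_assoc c, ← hd]
    exact ⟨c, d, by rw [mul_assoc, ← hc], by rw [← h2, h1], by rw [← mul_assoc, ← hd]⟩
  obtain ⟨c, d, h1, h2, h3⟩ := key hx hxz
  obtain ⟨c', d', h1', h2', h3'⟩ := key hy hyz
  have hzZ := (right_mem_diff hz hxz).2
  refine ⟨c * x, c' * y, c, left_mem_diff (b := z) (A.mul_mem_left _ hx) (h1.symm ▸ hzZ),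
    left_mem_diff (b := z) (A.mul_mem_left _ hy) (h1'.symm ▸ hzZ), ?_, ?_, ?_, rfl⟩
  · rw [h2', ← mul_assoc, h1]
  · rw [h2, ← mul_assoc, h1']
  · intro h
    exact hxy (y * c) (by rw [mul_assoc, h, h2', h3'])

/-- A loop inside a `𝒥`-class, with multipliers from below, yields two distinct idempotents that
are `ℒ`-related or `ℛ`-related. -/
theorem exists_pair_of_loop (hJ : IsJClass A Z) (hS : IsPseudoNilpotent S) {p : S × S}
    (hp : IsMalcevLoop (adjoinOne A.toSubsemigroup) p) (h1 : p.1 ∈ A.carrier)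
    (h2 : p.2 ∈ A.carrier) (h1' : p.1 ∉ Z.carrier) (h2' : p.2 ∉ Z.carrier) :
    ∃ e f, e ∈ A.carrier \ Z.carrier ∧ f ∈ A.carrier \ Z.carrier ∧ e ≠ f ∧
      ((e * f = e ∧ f * e = f) ∨ (e * f = f ∧ f * e = e)) := by
  -- Without such idempotents, elements with a common multiplier keeping them outside Z are
  -- ℛ-related (`hL`) or ℒ-related (`hR`). The loop supplies such multipliers for x and y, which
  -- become ℋ-related and regular.
  by_contra hcon
  have hL : ∀ {z x y : S}, z ∈ A.carrier → x ∈ A.carrier → y ∈ A.carrier → z * x ∉ Z.carrier →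
      z * y ∉ Z.carrier → ∃ s, y = x * s := by
    intro z x y hz hx hy hzx hzy
    by_contra! h
    obtain ⟨e, f, -, he, hf, h3, h4, h5, -⟩ := hJ.exists_left_pair hz hx hy hzx hzy h
    exact hcon ⟨e, f, he, hf, h5, Or.inl ⟨h3, h4⟩⟩
  have hR : ∀ {z x y : S}, z ∈ A.carrier → x ∈ A.carrier → y ∈ A.carrier → x * z ∉ Z.carrier →
      y * z ∉ Z.carrier → ∃ s, y = s * x := by
    intro z x y hz hx hy hzx hzy
    by_contra! h
    obtain ⟨e, f, -, he, hf, h3, h4, h5, -⟩ := hJ.exists_right_pair hz hx hy hzx hzy h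
    exact hcon ⟨e, f, he, hf, h5, Or.inr ⟨h3, h4⟩⟩
  have hback : ∀ {q : S × S}, ReflTransGen (MalcevStep (adjoinOne A.toSubsemigroup)) q p →
      q.1 ∉ Z.carrier ∧ q.2 ∉ Z.carrier := by
    intro q hq
    have : ¬ (q.1 ∈ Z.carrier ∨ q.2 ∈ Z.carrier) := by
      intro h
      rcases ReflTransGen.cases_head hq with rfl | ⟨r, hr, hr'⟩
      · exact h.elim h1' h2'
      · exact h1' (reflTransGen_mem_ideal hr' Z (hr.mem_ideal Z h)).1
    exact not_or.1 this
  obtain ⟨x, y⟩ := p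
  simp only at h1 h2 h1' h2'
  obtain ⟨q, ⟨w, hw, rfl⟩, hq, hloop⟩ := hp.exists_step
  obtain ⟨hq1, hq2⟩ := hback hq
  simp only at hq1 hq2
  suffices h : (∃ z ∈ A.carrier, z * x ∉ Z.carrier) ∧ (∃ a, y = x * a) ∧ (∃ b, y = b * x) by
    obtain ⟨⟨z, hz, hzx⟩, ⟨a, ha⟩, ⟨b, hb⟩⟩ := h
    obtain ⟨c, -, hc, -, -⟩ := hJ.regular_of_mul_notMem hz h1 hzx
    exact hS.not_loop_of_regular (p := (x, y)) ha hb hc (hp.mono (Set.subset_univ _))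
  induction w using WithOne.recOneCoe with
  | coe z =>
    have hz : z ∈ A.carrier := hw z rfl
    rw [sandwich_coe] at hq1 hq2
    have hzx : z * x ∉ Z.carrier := fun h => hq2 (mul_assoc y z x ▸ Z.mul_mem_left _ h)
    have hzy : z * y ∉ Z.carrier := fun h => hq1 (mul_assoc x z y ▸ Z.mul_mem_left _ h)
    have hxz : x * z ∉ Z.carrier := fun h => hq1 (Z.mul_mem_right _ h)
    have hyz : y * z ∉ Z.carrier := fun h => hq2 (Z.mul_mem_right _ h)
    exact ⟨⟨z, hz, hzx⟩, hL hz h1 h2 hzx hzy, hR hz h1 h2 hxz hyz⟩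
  | one =>
    rw [sandwich_one] at hq1 hq2
    refine ⟨⟨y, h2, hq2⟩, ?_⟩
    have hxyA : x * y ∈ A.carrier := A.mul_mem_left _ h2
    have hyxA : y * x ∈ A.carrier := A.mul_mem_left _ h1
    obtain ⟨q', ⟨w', hw', rfl⟩, hq', -⟩ := hloop.exists_step
    obtain ⟨hq1', hq2'⟩ := hback (hq'.trans hq)
    simp only [sandwich_one] at hq1' hq2'
    induction w' using WithOne.recOneCoe with
    | coe z =>
      have hz : z ∈ A.carrier := hw' z rfl
      rw [sandwich_coe] at hq1' hq2'
      have hzx : z * (x * y) ∉ Z.carrier :=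
        fun h => hq2' (mul_assoc (y * x) z _ ▸ Z.mul_mem_left _ h)
      have hzy : z * (y * x) ∉ Z.carrier :=
        fun h => hq1' (mul_assoc (x * y) z _ ▸ Z.mul_mem_left _ h)
      have hxz : x * y * z ∉ Z.carrier := fun h => hq1' (Z.mul_mem_right _ h)
      have hyz : y * x * z ∉ Z.carrier := fun h => hq2' (Z.mul_mem_right _ h)
      constructor
      · obtain ⟨s, hs⟩ := hL hz hxyA hyxA hzx hzy
        obtain ⟨t, ht⟩ := hJ.stable_right h2 hq2
        exact ⟨y * (s * t), ht.trans (by rw [hs]; simp only [mul_assoc])⟩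
      · obtain ⟨s, hs⟩ := hR hz hyxA hxyA hyz hxz
        obtain ⟨t, ht⟩ := hJ.stable_left h2 hq1
        exact ⟨t * (s * y), ht.trans (by rw [hs]; simp only [mul_assoc])⟩
    | one =>
      rw [sandwich_one] at hq1'
      -- Two successive multipliers 1 produce the factor yy, so y itself serves as common multiplier
      -- of x and y.
      have hyy : y * y ∉ Z.carrier := by
        intro h
        refine hq1' ?_
        have : x * y * (y * x) = x * (y * y) * x := by simp only [mul_assoc]
        rw [this]
        exact Z.mul_mem_right _ (Z.mul_mem_left _ h)
      exact ⟨hL h2 h1 h2 hq2 hyy, hR h2 h1 h2 hq1 hyy⟩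

end IsJClass
end JClass

/-! ### A 𝒥-class carrying a loop is closed under multiplication. -/

section Wide

variable {S : Type*} [Semigroup S] {A Z : SgIdeal S}

theorem mul_self_of_left_pair {e f : S} (hef : e * f = e) (hfe : f * e = f) : e * e = e :=
  calc e * e = e * f * e := by rw [hef]
    _ = e := by rw [mul_assoc, hfe, hef]

theorem mul_self_of_right_pair {e f : S} (hef : e * f = f) (hfe : f * e = e) : e * e = e :=
  calc e * e = e * (f * e) := by rw [hfe]
    _ = e := by rw [← mul_assoc, hef, hfe]

theorem IsMalcevLoop.exists_step_notMem {W : Set (WithOne S)} {p : S × S}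
    (hp : IsMalcevLoop W p) (h1 : p.1 ∉ Z.carrier) :
    ∃ w ∈ W, sandwich p.1 w p.2 ∉ Z.carrier ∧ sandwich p.2 w p.1 ∉ Z.carrier := by
  obtain ⟨q, ⟨w, hw, rfl⟩, hq, hl⟩ := hp.exists_step
  have h : ¬ (sandwich p.1 w p.2 ∈ Z.carrier ∨ sandwich p.2 w p.1 ∈ Z.carrier) := fun h =>
    h1 (reflTransGen_mem_ideal hq Z (hl.mem_ideal Z h)).1
  exact ⟨w, hw, not_or.1 h⟩

theorem sandwich_eq_mul_left {P : Subsemigroup S} {b u v : S} {w : WithOne S}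
    (hP : ∀ s ∈ P, ∃ g, s = g * b) (hw : w ∈ adjoinOne P) (hu : u ∈ P) :
    ∃ g, sandwich u w v = g * (b * v) := by
  induction w using WithOne.recOneCoe with
  | one =>
    obtain ⟨g, rfl⟩ := hP u hu
    exact ⟨g, by rw [sandwich_one, mul_assoc]⟩
  | coe z =>
    obtain ⟨g, rfl⟩ := hP z (hw z rfl)
    exact ⟨u * g, by rw [sandwich_coe]; simp only [mul_assoc]⟩

theorem sandwich_eq_mul_right {P : Subsemigroup S} {a u v : S} {w : WithOne S}
    (hP : ∀ s ∈ P, ∃ g, s = a * g) (hw : w ∈ adjoinOne P) (hv : v ∈ P) :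
    ∃ g, sandwich u w v = u * a * g := by
  induction w using WithOne.recOneCoe with
  | one =>
    obtain ⟨g, rfl⟩ := hP v hv
    exact ⟨g, by rw [sandwich_one, mul_assoc]⟩
  | coe z =>
    obtain ⟨g, rfl⟩ := hP z (hw z rfl)
    exact ⟨g * v, by rw [sandwich_coe]; simp only [mul_assoc]⟩

namespace IsJClass

variable [Finite S]

/-- Being fixed by e and divisible by b places r.1 in the ℛ-class of e and the ℒ-class of b. Then
r.2 is a right and a left multiple of r.1, and r.1 is regular because e ∈ r.1 S. -/
theorem not_loop_of_left (hJ : IsJClass A Z) (hS : IsPseudoNilpotent S) {e b : S} {r : S × S}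
    (he : e ∈ A.carrier) (hb : b ∈ A.carrier) (h1 : r.1 ∉ Z.carrier)
    (he1 : e * r.1 = r.1) (he2 : e * r.2 = r.2) (hb1 : ∃ g, r.1 = g * b)
    (hb2 : ∃ g, r.2 = g * b) : ¬ IsMalcevLoop Set.univ r := by
  obtain ⟨g1, hg1⟩ := hb1
  obtain ⟨g2, hg2⟩ := hb2
  obtain ⟨c, hc⟩ := hJ.stable_right he (he1.symm ▸ h1)
  obtain ⟨k, hk⟩ := hJ.stable_left (x := g1) hb (hg1 ▸ h1)
  rw [he1] at hc
  rw [← hg1] at hk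
  refine hS.not_loop_of_regular (a := c * r.2) (b := g2 * k) (c := c) ?_ ?_ ?_
  · rw [← mul_assoc, ← hc, he2]
  · rw [mul_assoc, ← hk, hg2]
  · rw [← hc, he1]

theorem not_loop_of_right (hJ : IsJClass A Z) (hS : IsPseudoNilpotent S) {e a : S} {r : S × S}
    (he : e ∈ A.carrier) (ha : a ∈ A.carrier) (h1 : r.1 ∉ Z.carrier)
    (he1 : r.1 * e = r.1) (he2 : r.2 * e = r.2) (ha1 : ∃ g, r.1 = a * g)
    (ha2 : ∃ g, r.2 = a * g) : ¬ IsMalcevLoop Set.univ r := by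
  obtain ⟨g1, hg1⟩ := ha1
  obtain ⟨g2, hg2⟩ := ha2
  obtain ⟨c, hc⟩ := hJ.stable_left he (he1.symm ▸ h1)
  obtain ⟨k, hk⟩ := hJ.stable_right (y := g1) ha (hg1 ▸ h1)
  rw [he1] at hc
  rw [← hg1] at hk
  refine hS.not_loop_of_regular (a := k * g2) (b := r.2 * c) (c := c) ?_ ?_ ?_
  · rw [← mul_assoc, ← hk, hg2]
  · rw [mul_assoc, ← hc, he2]
  · rw [mul_assoc, ← hc, he1]

/-- If a `𝒥`-class of a pseudo-nilpotent semigroup contains two distinct `ℒ`-related idempotents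
`e` and `f`, then it is closed under right multiplication by `e`. -/
theorem mul_left_pair (hJ : IsJClass A Z) (hS : IsPseudoNilpotent S) {e f : S}
    (he : e ∈ A.carrier \ Z.carrier) (hf : f ∈ A.carrier \ Z.carrier) (hef : e * f = e)
    (hfe : f * e = f) (hne : e ≠ f) {c : S} (hc : c ∈ A.carrier \ Z.carrier) :
    c * e ∉ Z.carrier := by
  have hee : e * e = e := mul_self_of_left_pair hef hfe
  have hff : f * f = f := mul_self_of_left_pair hfe hef
  obtain ⟨a, b, ha, hb, hab, hae, heb⟩ := hJ.exists_factor hc he hee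
  have hafb : a * (f * b) = c := by rw [← mul_assoc, ← hae, mul_assoc a, hef, hae, hab]
  obtain ⟨d, hd⟩ := hJ.stable_right (y := b) he.1 (heb.symm ▸ hb.2)
  rw [heb] at hd
  have hfbZ : f * b ∉ Z.carrier := fun h => hc.2 (hafb ▸ Z.mul_mem_left a h)
  -- As e = bd, the multiplier de fixes the pair (b, fb) in one step.
  have hloop : IsMalcevLoop Set.univ (b, f * b) := by
    refine ⟨.single ⟨((d * e : S) : WithOne S), trivial, ?_⟩, ?_⟩
    · simp only [sandwich_coe]
      have h1 : b * (d * e) * (f * b) = b := by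
        rw [← mul_assoc b, ← hd, hee, ← mul_assoc, hef, heb]
      have h2 : f * b * (d * e) * b = f * b := by
        rw [mul_assoc f, ← mul_assoc b, ← hd, hee, hfe]
      rw [h1, h2]
    · intro h
      replace h : b = f * b := h
      apply hne
      rw [hd, h, mul_assoc, ← hd, hfe]
  obtain ⟨r, hr1, hr2, hr3, hr4, hr⟩ := hS.exists_loop .refl hloop Z hb.2 hfbZ
  simp only at hr1 hr2 hr
  set P := Subsemigroup.closure {b, f * b} with hP
  have hPb : ∀ s ∈ P, (∃ g, s = g * b) ∧ (e * s = s ∨ f * s = s) := by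
    intro s hs
    induction hs using Subsemigroup.closure_induction with
    | mem x hx =>
      rcases hx with rfl | rfl
      · exact ⟨⟨e, heb.symm⟩, Or.inl heb⟩
      · exact ⟨⟨f, rfl⟩, Or.inr (by rw [← mul_assoc, hff])⟩
    | mul x y _ _ hx hy =>
      obtain ⟨⟨g, rfl⟩, -⟩ := hy
      refine ⟨⟨x * g, (mul_assoc _ _ _).symm⟩, hx.2.imp ?_ ?_⟩ <;>
      · intro h
        rw [← mul_assoc, h]
  have hA : ∀ s ∈ P, s ∈ A.carrier := by
    intro s hs
    obtain ⟨⟨g, rfl⟩, -⟩ := hPb s hs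
    exact A.mul_mem_left _ hb.1
  obtain ⟨w, hw, hw1, hw2⟩ := hr.exists_step_notMem hr3
  have hbr2 : b * r.2 ∉ Z.carrier := by
    obtain ⟨g, hg⟩ := sandwich_eq_mul_left (v := r.2) (fun s hs => (hPb s hs).1) hw hr1
    exact fun h => hw1 (hg ▸ Z.mul_mem_left _ h)
  have hbr1 : b * r.1 ∉ Z.carrier := by
    obtain ⟨g, hg⟩ := sandwich_eq_mul_left (v := r.1) (fun s hs => (hPb s hs).1) hw hr2
    exact fun h => hw2 (hg ▸ Z.mul_mem_left _ h)
  have hru := hr.mono (Set.subset_univ _)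
  -- If neither entry is known to be fixed by e, both are fixed by f and divisible by b, which
  -- excludes a loop.
  have hbe : b * e ∉ Z.carrier := by
    rcases (hPb _ hr1).2 with h1 | h1
    · rw [← h1, ← mul_assoc] at hbr1
      exact fun h => hbr1 (Z.mul_mem_right _ h)
    rcases (hPb _ hr2).2 with h2 | h2
    · rw [← h2, ← mul_assoc] at hbr2
      exact fun h => hbr2 (Z.mul_mem_right _ h)
    exact absurd hru (hJ.not_loop_of_left hS hf.1 hb.1 hr3 h1 h2 (hPb _ hr1).1 (hPb _ hr2).1)
  rw [← hab]
  exact hJ.mul_mul_notMem hb.1 (hab ▸ hc.2) hbe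

theorem mul_right_pair (hJ : IsJClass A Z) (hS : IsPseudoNilpotent S) {e f : S}
    (he : e ∈ A.carrier \ Z.carrier) (hf : f ∈ A.carrier \ Z.carrier) (hef : e * f = f)
    (hfe : f * e = e) (hne : e ≠ f) {c : S} (hc : c ∈ A.carrier \ Z.carrier) :
    e * c ∉ Z.carrier := by
  have hee : e * e = e := mul_self_of_right_pair hef hfe
  have hff : f * f = f := mul_self_of_right_pair hfe hef
  obtain ⟨a, b, ha, hb, hab, hae, heb⟩ := hJ.exists_factor hc he hee
  have hafb : a * f * b = c := by rw [← heb, mul_assoc, ← mul_assoc f, hfe, heb, hab]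
  obtain ⟨d, hd⟩ := hJ.stable_left (x := a) he.1 (hae.symm ▸ ha.2)
  rw [hae] at hd
  have hafZ : a * f ∉ Z.carrier := fun h => hc.2 (hafb ▸ Z.mul_mem_right b h)
  have h1 : a * (e * d) * (a * f) = a * f := by
    rw [← mul_assoc, mul_assoc _ _ a, mul_assoc e, ← hd, hee, hae]
  have h2 : a * f * (e * d) * a = a := by
    rw [mul_assoc _ _ a, mul_assoc e, ← hd, hee, mul_assoc, hfe, hae]
  -- In contrast to the left case this step swaps the entries, so the loop has length two.
  have hloop : IsMalcevLoop Set.univ (a, a * f) := by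
    refine ⟨.head (b := (a * f, a)) ⟨((e * d : S) : WithOne S), trivial, ?_⟩
      (.single ⟨((e * d : S) : WithOne S), trivial, ?_⟩), ?_⟩
    · simp only [sandwich_coe, h1, h2]
    · simp only [sandwich_coe, h1, h2]
    · intro h
      replace h : a = a * f := h
      apply hne
      rw [hd, h, ← mul_assoc, ← hd, hef]
  obtain ⟨r, hr1, hr2, hr3, hr4, hr⟩ := hS.exists_loop .refl hloop Z ha.2 hafZ
  simp only at hr1 hr2 hr
  set P := Subsemigroup.closure {a, a * f} with hP
  have hPb : ∀ s ∈ P, (∃ g, s = a * g) ∧ (s * e = s ∨ s * f = s) := by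
    intro s hs
    induction hs using Subsemigroup.closure_induction with
    | mem x hx =>
      rcases hx with rfl | rfl
      · exact ⟨⟨e, hae.symm⟩, Or.inl hae⟩
      · exact ⟨⟨f, rfl⟩, Or.inr (by rw [mul_assoc, hff])⟩
    | mul x y _ _ hx hy =>
      obtain ⟨⟨g, rfl⟩, -⟩ := hx
      refine ⟨⟨g * y, mul_assoc _ _ _⟩, hy.2.imp ?_ ?_⟩ <;>
      · intro h
        rw [mul_assoc, h]
  obtain ⟨w, hw, hw1, hw2⟩ := hr.exists_step_notMem hr3
  have hr1a : r.1 * a ∉ Z.carrier := by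
    obtain ⟨g, hg⟩ := sandwich_eq_mul_right (u := r.1) (fun s hs => (hPb s hs).1) hw hr2
    exact fun h => hw1 (hg ▸ Z.mul_mem_right _ h)
  have hr2a : r.2 * a ∉ Z.carrier := by
    obtain ⟨g, hg⟩ := sandwich_eq_mul_right (u := r.2) (fun s hs => (hPb s hs).1) hw hr1
    exact fun h => hw2 (hg ▸ Z.mul_mem_right _ h)
  have hru := hr.mono (Set.subset_univ _)
  have hea : e * a ∉ Z.carrier := by
    rcases (hPb _ hr1).2 with h1 | h1
    · rw [← h1, mul_assoc] at hr1a
      exact fun h => hr1a (Z.mul_mem_left _ h)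
    rcases (hPb _ hr2).2 with h2 | h2
    · rw [← h2, mul_assoc] at hr2a
      exact fun h => hr2a (Z.mul_mem_left _ h)
    exact absurd hru (hJ.not_loop_of_right hS hf.1 ha.1 hr3 h1 h2 (hPb _ hr1).1 (hPb _ hr2).1)
  rw [← hab, ← mul_assoc]
  exact hJ.mul_mul_notMem ha.1 hea (hab ▸ hc.2)

/-- A loop inside a `𝒥`-class, with multipliers from below, forces the `𝒥`-class to be a
subsemigroup with at least two `ℋ`-classes. -/
theorem isWide_of_loop (hJ : IsJClass A Z) (hS : IsPseudoNilpotent S) {p : S × S}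
    (hp : IsMalcevLoop (adjoinOne A.toSubsemigroup) p) (h1 : p.1 ∈ A.carrier)
    (h2 : p.2 ∈ A.carrier) (h1' : p.1 ∉ Z.carrier) (h2' : p.2 ∉ Z.carrier) : IsWide A Z := by
  obtain ⟨e, f, he, hf, hne, h | h⟩ := hJ.exists_pair_of_loop hS hp h1 h2 h1' h2'
  · obtain ⟨hef, hfe⟩ := h
    have hee : e * e = e := mul_self_of_left_pair hef hfe
    refine ⟨fun a ha b hb => ⟨A.mul_mem_left _ hb.1, ?_⟩, e, he, f, hf, Or.inl ?_⟩
    · by_cases hall : ∀ d ∈ A.carrier \ Z.carrier, ∃ s, d = s * a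
      · obtain ⟨p, q, hp, hq, rfl, hpe, heq⟩ := hJ.exists_factor hb he hee
        obtain ⟨d, hd⟩ := hJ.stable_left (x := p) he.1 (hpe.symm ▸ hp.2)
        rw [hpe] at hd
        have hz : e * d * (p * q) = q := by
          rw [← mul_assoc, mul_assoc e, ← hd, hee, heq]
        obtain ⟨s, hs⟩ := hall (e * d) (left_mem_diff (b := p * q) (A.mul_mem_right _ he.1)
          (hz.symm ▸ hq.2))
        intro h
        apply hq.2
        rw [← hz, hs, mul_assoc]
        exact Z.mul_mem_left _ h
      · push Not at hall
        obtain ⟨d, hd, hda⟩ := hall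
        obtain ⟨e', f', g, he', hf', h1, h2, h3, rfl⟩ := hJ.exists_right_pair he.1 ha.1 hd.1
          (hJ.mul_left_pair hS he hf hef hfe hne ha) (hJ.mul_left_pair hS he hf hef hfe hne hd) hda
        have := hJ.mul_right_pair hS he' hf' h1 h2 h3 hb
        rw [mul_assoc] at this
        exact fun h => this (Z.mul_mem_left _ h)
    · intro s hs
      apply hne
      calc e = e * f := hef.symm
        _ = e * e * s := by rw [hs, mul_assoc]
        _ = f := by rw [hee, hs]
  · obtain ⟨hef, hfe⟩ := h
    have hee : e * e = e := mul_self_of_right_pair hef hfe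
    refine ⟨fun a ha b hb => ⟨A.mul_mem_left _ hb.1, ?_⟩, e, he, f, hf, Or.inr ?_⟩
    · by_cases hall : ∀ d ∈ A.carrier \ Z.carrier, ∃ s, d = b * s
      · obtain ⟨p, q, hp, hq, rfl, hpe, heq⟩ := hJ.exists_factor ha he hee
        obtain ⟨d, hd⟩ := hJ.stable_right (y := q) he.1 (heq.symm ▸ hq.2)
        rw [heq] at hd
        have hz : p * q * (d * e) = p := by
          rw [← mul_assoc, mul_assoc p, ← hd, hpe, hpe]
        obtain ⟨s, hs⟩ := hall (d * e) (right_mem_diff (a := p * q) (A.mul_mem_left _ he.1)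
          (hz.symm ▸ hp.2))
        intro h
        apply hp.2
        rw [← hz, hs, ← mul_assoc]
        exact Z.mul_mem_right _ h
      · push Not at hall
        obtain ⟨d, hd, hdb⟩ := hall
        obtain ⟨e', f', g, he', hf', h1, h2, h3, rfl⟩ := hJ.exists_left_pair he.1 hb.1 hd.1
          (hJ.mul_right_pair hS he hf hef hfe hne hb)
          (hJ.mul_right_pair hS he hf hef hfe hne hd) hdb
        have := hJ.mul_left_pair hS he' hf' h1 h2 h3 ha
        rw [← mul_assoc] at this
        exact fun h => this (Z.mul_mem_right _ h)
    · intro s hs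
      apply hne
      calc e = f * e := hfe.symm
        _ = s * (e * e) := by rw [hs, mul_assoc]
        _ = f := by rw [hee, hs]

end IsJClass

end Wide

/-! ### Divisibility of loop entries by the generators. -/

/-- The principal ideal `S¹ a S¹`. -/
def principalIdeal {S : Type*} [Semigroup S] (a : S) : SgIdeal S where
  carrier := {b | ∃ c d : WithOne S, (b : WithOne S) = c * a * d}
  mul_mem_left := by
    rintro s b ⟨c, d, h⟩
    exact ⟨s * c, d, by rw [WithOne.coe_mul, h]; simp only [mul_assoc]⟩
  mul_mem_right := by
    rintro s b ⟨c, d, h⟩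
    exact ⟨c, d * s, by rw [WithOne.coe_mul, h]; simp only [mul_assoc]⟩

/-- The elements acting on `A \ Z` without leaving it. -/
def actSet {S : Type*} [Semigroup S] (A Z : SgIdeal S) : Set S :=
  {s | ∃ j ∈ A.carrier \ Z.carrier, s * j ∈ A.carrier \ Z.carrier}

section Ideal

variable {S : Type*} [Semigroup S]

theorem self_mem_principalIdeal (a : S) : a ∈ (principalIdeal a).carrier :=
  ⟨1, 1, by rw [one_mul, mul_one]⟩

theorem SgIdeal.mem_of_coe_eq (I : SgIdeal S) {a b : S} (ha : a ∈ I.carrier) {c d : WithOne S}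
    (h : (b : WithOne S) = c * a * d) : b ∈ I.carrier := by
  obtain ⟨s, hs⟩ := exists_coe_eq_mul_coe a c
  have hsI : s ∈ I.carrier := by
    induction c using WithOne.recOneCoe with
    | one =>
      rw [one_mul, WithOne.coe_inj] at hs
      exact hs ▸ ha
    | coe z =>
      rw [← WithOne.coe_mul, WithOne.coe_inj] at hs
      exact hs ▸ I.mul_mem_left _ ha
  rw [← hs] at h
  induction d using WithOne.recOneCoe with
  | one =>
    rw [mul_one, WithOne.coe_inj] at h
    exact h ▸ hsI
  | coe z =>
    rw [← WithOne.coe_mul, WithOne.coe_inj] at h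
    exact h ▸ I.mul_mem_right _ hsI

theorem mul_comm_of_mem_closure_singleton {y a b : S} (ha : a ∈ Subsemigroup.closure {y})
    (hb : b ∈ Subsemigroup.closure {y}) : a * b = b * a := by
  have hc : ∀ a ∈ ({y} : Set S), ∀ b ∈ ({y} : Set S), a * b = b * a := by
    rintro a rfl b rfl
    rfl
  exact congrArg Subtype.val
    ((Subsemigroup.isMulCommutative_closure S hc).is_comm.comm ⟨a, ha⟩ ⟨b, hb⟩)

/-- The entries of a loop of `⟨x, y⟩` are divisible by `x`. -/
theorem IsMalcevLoop.mem_principalIdeal {x y : S} {p : S × S}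
    (hp : IsMalcevLoop (adjoinOne (Subsemigroup.closure {x, y})) p)
    (h1 : p.1 ∈ Subsemigroup.closure {x, y}) (h2 : p.2 ∈ Subsemigroup.closure {x, y}) :
    p.1 ∈ (principalIdeal x).carrier := by
  by_contra hx1
  have hx2 : p.2 ∉ (principalIdeal x).carrier := fun h => hx1 (hp.mem_ideal _ (Or.inr h)).1
  -- Words without x are powers of y. A loop avoiding the ideal of x would live among commuting
  -- elements and collapse after one step.
  have hcl : ∀ s ∈ Subsemigroup.closure {x, y}, s ∉ (principalIdeal x).carrier →
      s ∈ Subsemigroup.closure {y} := by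
    intro s hs
    induction hs using Subsemigroup.closure_induction with
    | mem s hs =>
      rcases hs with rfl | rfl
      · exact fun h => absurd (self_mem_principalIdeal s) h
      · exact fun _ => Subsemigroup.subset_closure rfl
    | mul s t _ _ hs ht =>
      exact fun h => mul_mem (hs fun h' => h ((principalIdeal x).mul_mem_right _ h'))
        (ht fun h' => h ((principalIdeal x).mul_mem_left _ h'))
  have h1' := hcl _ h1 hx1
  have h2' := hcl _ h2 hx2
  obtain ⟨q, ⟨w, hw, rfl⟩, hq, hloop⟩ := hp.exists_step
  apply hloop.2
  simp only
  induction w using WithOne.recOneCoe with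
  | one => exact mul_comm_of_mem_closure_singleton h1' h2'
  | coe z =>
    have hz : z ∈ Subsemigroup.closure {y} := by
      refine hcl z (hw z rfl) fun h => ?_
      refine hx1 (reflTransGen_mem_ideal hq (principalIdeal x) ⟨?_, ?_⟩).1 <;>
        exact (principalIdeal x).mul_mem_right _ ((principalIdeal x).mul_mem_left _ h)
    rw [sandwich_coe, sandwich_coe, mul_comm_of_mem_closure_singleton (mul_mem h1' hz) h2',
      mul_comm_of_mem_closure_singleton h1' hz, mul_assoc]

end Ideal

/-! ### Elements acting on a wide 𝒥-class. -/

section Act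

variable {S : Type*} [Semigroup S] {A Z : SgIdeal S}

/-- From (js)j₀ = j(sj₀) and closure under products, acting on one element from the left implies
acting on all elements from both sides. -/
theorem IsWide.act (hW : IsWide A Z) {s j : S} (hs : s ∈ actSet A Z)
    (hj : j ∈ A.carrier \ Z.carrier) :
    s * j ∈ A.carrier \ Z.carrier ∧ j * s ∈ A.carrier \ Z.carrier := by
  obtain ⟨j₀, hj₀, hsj⟩ := hs
  have h1 : j * s ∈ A.carrier \ Z.carrier := by
    refine ⟨A.mul_mem_right _ hj.1, fun h => (hW.1 j hj _ hsj).2 ?_⟩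
    rw [← mul_assoc]
    exact Z.mul_mem_right _ h
  refine ⟨⟨A.mul_mem_left _ hj.1, fun h => (hW.1 _ h1 j hj).2 ?_⟩, h1⟩
  rw [mul_assoc]
  exact Z.mul_mem_left _ h

theorem IsWide.subset_actSet (hW : IsWide A Z) : A.carrier \ Z.carrier ⊆ actSet A Z :=
  fun s hs => ⟨s, hs, hW.1 s hs s hs⟩

theorem IsWide.mul_mem_actSet (hW : IsWide A Z) {s t : S} (hs : s ∈ actSet A Z)
    (ht : t ∈ actSet A Z) : s * t ∈ actSet A Z := by
  obtain ⟨j, hj, htj⟩ := ht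
  exact ⟨j, hj, by rw [mul_assoc]; exact (hW.act hs htj).1⟩

theorem mem_actSet_of_dvd {j t x : S} {c d : WithOne S} (hj : j ∈ A.carrier)
    (htj : t * j ∉ Z.carrier) (ht : (t : WithOne S) = c * x * d) : x ∈ actSet A Z := by
  obtain ⟨k, hk⟩ := exists_coe_eq_mul_coe j d
  have hkA : k ∈ A.carrier := A.mem_of_coe_eq hj (d := 1) (by rw [hk, mul_one])
  have hxk : x * k ∉ Z.carrier := by
    intro h
    refine htj (Z.mem_of_coe_eq h (c := c) (d := 1) ?_)
    rw [WithOne.coe_mul, WithOne.coe_mul, ht, hk, mul_one]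
    simp only [mul_assoc]
  exact ⟨k, right_mem_diff hkA hxk, A.mul_mem_left _ hkA, hxk⟩

/-- Two elements of `A \ Z` that are not `ℋ`-related. -/
def IsSpread (A Z : SgIdeal S) (q : S × S) : Prop :=
  q.1 ∈ A.carrier \ Z.carrier ∧ q.2 ∈ A.carrier \ Z.carrier ∧
    ((∀ s, q.2 ≠ q.1 * s) ∨ (∀ s, q.2 ≠ s * q.1))

variable [Finite S]

theorem IsSpread.ne (hJ : IsJClass A Z) (hW : IsWide A Z) {q : S × S} (hq : IsSpread A Z q) :
    q.1 ≠ q.2 := by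
  obtain ⟨h1, -, h⟩ := hq
  intro he
  have hqq := (hW.1 _ h1 _ h1).2
  rcases h with h | h
  · obtain ⟨c, hc⟩ := hJ.stable_right h1.1 hqq
    exact h (q.1 * c) (by rw [← he, ← mul_assoc, ← hc])
  · obtain ⟨c, hc⟩ := hJ.stable_left h1.1 hqq
    exact h (c * q.1) (by rw [← he, mul_assoc, ← hc])

/-- ab is ℛ-related to a and ℒ-related to b, and dually for ba; an ℋ-relation between ab and ba
would give one between a and b. -/
theorem IsSpread.mul (hJ : IsJClass A Z) (hW : IsWide A Z) {q : S × S} (hq : IsSpread A Z q) :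
    IsSpread A Z (q.1 * q.2, q.2 * q.1) := by
  obtain ⟨h1, h2, h⟩ := hq
  have h12 := hW.1 _ h1 _ h2
  have h21 := hW.1 _ h2 _ h1
  refine ⟨h12, h21, h.imp (fun h s hs => ?_) (fun h s hs => ?_)⟩
  · obtain ⟨c, hc⟩ := hJ.stable_right h2.1 h21.2
    simp only at hs
    exact h (q.2 * (s * c)) (hc.trans (by rw [hs]; simp only [mul_assoc]))
  · simp only at hs
    obtain ⟨c, hc⟩ := hJ.stable_left h1.1 h21.2
    have hx : q.1 = c * (s * q.1) * q.2 := hc.trans (by rw [hs]; simp only [mul_assoc])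
    obtain ⟨d, hd⟩ := hJ.stable_left (x := c * (s * q.1)) h2.1 (hx ▸ h1.2)
    rw [← hx] at hd
    exact h d hd

theorem IsSpread.exists_loop (hJ : IsJClass A Z) (hW : IsWide A Z) {q : S × S}
    (hq : IsSpread A Z q) :
    ∃ r, ReflTransGen (MalcevStep Set.univ) q r ∧ IsMalcevLoop Set.univ r := by
  let f : S × S → S × S := fun q => (q.1 * q.2, q.2 * q.1)
  have hf : ∀ n, IsSpread A Z (f^[n] q) := by
    intro n
    induction n with
    | zero => exact hq
    | succ n ih =>
      rw [Function.iterate_succ_apply']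
      exact ih.mul hJ hW
  have hstep : ∀ n m, n < m → TransGen (MalcevStep Set.univ) (f^[n] q) (f^[m] q) := by
    intro n m h
    have hs : ∀ k, MalcevStep Set.univ (f^[k] q) (f^[k + 1] q) := fun k => by
      rw [Function.iterate_succ_apply']
      exact ⟨1, trivial, rfl⟩
    induction m, h using Nat.le_induction with
    | base => exact .single (hs n)
    | succ m _ ih => exact ih.tail (hs m)
  have key : ∀ n m, n < m → f^[n] q = f^[m] q →
      ∃ r, ReflTransGen (MalcevStep Set.univ) q r ∧ IsMalcevLoop Set.univ r := by
    intro n m hnm he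
    refine ⟨f^[n] q, ?_, ?_, (hf n).ne hJ hW⟩
    · rcases Nat.eq_zero_or_pos n with rfl | hn
      · exact .refl
      · exact (hstep 0 n hn).to_reflTransGen
    · have := hstep n m hnm
      rwa [← he] at this
  have hni : ¬ Function.Injective fun n : ℕ => f^[n] q := not_injective_infinite_finite _
  simp only [Function.Injective, not_forall] at hni
  obtain ⟨n, m, hnm, hne⟩ := hni
  rcases lt_or_gt_of_ne hne with h | h
  · exact key n m h hnm
  · exact key m n h hnm.symm

theorem adj_of_isSpread_step (hS : IsPseudoNilpotent S) (hJ : IsJClass A Z)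
    (hW : IsWide A Z) {s t w : S} (h : IsSpread A Z (s * w * t, t * w * s)) :
    (upperNonNilpotentGraph S).Adj s t := by
  obtain ⟨r, h1, h2⟩ := h.exists_loop hJ hW
  exact hS.adj (p := (s, t)) (.head ⟨(w : WithOne S), trivial, rfl⟩ h1) h2

/-- Stability gives swa ℛ sw, aws ℛ a, swa ℒ a and aws ℒ ws, so the hypothesis makes the pair (swa,
aws) spread. -/
theorem adj_of_not_related (hS : IsPseudoNilpotent S) (hJ : IsJClass A Z)
    (hW : IsWide A Z) {s a w : S} (hs : s ∈ actSet A Z) (ha : a ∈ A.carrier \ Z.carrier)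
    (hw : w ∈ A.carrier \ Z.carrier) (h : (∀ t, a ≠ s * w * t) ∨ (∀ t, a ≠ t * (w * s))) :
    (upperNonNilpotentGraph S).Adj s a := by
  have hsw := (hW.act hs hw).1
  have hws := (hW.act hs hw).2
  have h1 := hW.1 _ hsw _ ha
  have h2 : a * w * s ∈ A.carrier \ Z.carrier := by
    rw [mul_assoc]
    exact hW.1 _ ha _ hws
  refine adj_of_isSpread_step hS hJ hW (w := w) ⟨h1, h2, h.imp (fun h t ht => ?_)
    (fun h t ht => ?_)⟩
  · simp only at ht
    have h3 := h2.2
    rw [mul_assoc] at h3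
    obtain ⟨c, hc⟩ := hJ.stable_right ha.1 h3
    exact h (a * t * c) (hc.trans (by rw [← mul_assoc a, ht]; simp only [mul_assoc]))
  · simp only at ht
    have h3 : t * (s * w) * a = a * w * s := ht.symm ▸ (mul_assoc _ _ _)
    obtain ⟨c, hc⟩ := hJ.stable_left (x := t * (s * w)) ha.1 (h3 ▸ h2.2)
    exact h (c * a) (hc.trans (by rw [h3]; simp only [mul_assoc]))

/-- Two elements acting on a wide `𝒥`-class are adjacent or have a common neighbour in it. -/
theorem adj_or_exists_common_neighbour (hS : IsPseudoNilpotent S) (hJ : IsJClass A Z)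
    (hW : IsWide A Z) {s t : S} (hs : s ∈ actSet A Z) (ht : t ∈ actSet A Z) :
    (upperNonNilpotentGraph S).Adj s t ∨ ∃ a ∈ A.carrier \ Z.carrier,
      (upperNonNilpotentGraph S).Adj s a ∧ (upperNonNilpotentGraph S).Adj t a := by
  by_cases hadj : (upperNonNilpotentGraph S).Adj s t
  · exact Or.inl hadj
  obtain ⟨e, he, f, hf, hef⟩ := hW.2
  have hse := hW.act hs he
  have hte := hW.act ht he
  have h1 : s * e * t ∈ A.carrier \ Z.carrier := (hW.act ht hse.1).2
  have h2 : t * e * s ∈ A.carrier \ Z.carrier := (hW.act hs hte.1).2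
  -- Non-adjacency prevents (set, tes) from being spread.
  have hrel : (∃ c, t * e * s = s * e * t * c) ∧ (∃ c, t * e * s = c * (s * e * t)) := by
    have := mt (adj_of_isSpread_step hS hJ hW (s := s) (t := t) (w := e)) hadj
    simp only [IsSpread, h1, h2, true_and] at this
    push Not at this
    exact this
  obtain ⟨⟨c, hc⟩, ⟨d, hd⟩⟩ := hrel
  have hR : ∃ u, t * e = s * e * u := by
    obtain ⟨k, hk⟩ := hJ.stable_right hte.1.1 h2.2
    exact ⟨t * c * k, hk.trans (by rw [hc]; simp only [mul_assoc])⟩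
  have hL : ∃ u, e * t = u * (e * s) := by
    have h3 : s * (e * t) ∉ Z.carrier := by
      rw [← mul_assoc]
      exact h1.2
    obtain ⟨k, hk⟩ := hJ.stable_left hte.2.1 h3
    obtain ⟨l, hl⟩ := hJ.stable_left h1.1 (hd ▸ h2.2)
    rw [← hd] at hl
    exact ⟨k * l * t, hk.trans (by rw [← mul_assoc s, hl]; simp only [mul_assoc])⟩
  obtain ⟨u, hu⟩ := hR
  obtain ⟨v, hv⟩ := hL
  -- If every element were in seS and in Ses, there would be only one ℋ-class.
  obtain ⟨a, ha, hsa⟩ : ∃ a ∈ A.carrier \ Z.carrier,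
      (∀ k, a ≠ s * e * k) ∨ (∀ k, a ≠ k * (e * s)) := by
    by_contra! hcon
    rcases hef with hef | hef
    · obtain ⟨k, hk⟩ := (hcon e he).1
      obtain ⟨l, hl⟩ := (hcon f hf).1
      obtain ⟨c, hc⟩ := hJ.stable_right hse.1.1 (hk ▸ he.2)
      rw [← hk] at hc
      exact hef (c * l) (hl.trans (by rw [← mul_assoc, ← hc]))
    · obtain ⟨k, hk⟩ := (hcon e he).2
      obtain ⟨l, hl⟩ := (hcon f hf).2
      obtain ⟨c, hc⟩ := hJ.stable_left hse.2.1 (hk ▸ he.2)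
      rw [← hk] at hc
      exact hef (l * c) (hl.trans (by rw [mul_assoc, ← hc]))
  refine Or.inr ⟨a, ha, adj_of_not_related hS hJ hW hs ha he hsa,
    adj_of_not_related hS hJ hW ht ha he (hsa.imp (fun h k hk => ?_) (fun h k hk => ?_))⟩
  · exact h (u * k) (hk.trans (by rw [hu]; simp only [mul_assoc]))
  · exact h (k * v) (hk.trans (by rw [hv]; simp only [mul_assoc]))

end Act

/-! ### Layers of the principal series and stems. -/

namespace PrincipalSeries

section Layers

variable {S : Type*} [Semigroup S] {m : ℕ} (P : PrincipalSeries S m)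

theorem antitone_term : Antitone fun i => (P.term i).carrier :=
  Fin.antitone_iff_succ_le.2 fun i => (P.ssubset i).1

theorem layer_nonempty (i : Fin m) : (P.layer i).Nonempty :=
  Set.nonempty_of_ssubset (P.ssubset i)

/-- For a in the layer, S_{i+1} ∪ S¹aS¹ is an ideal strictly above S_{i+1}, hence all of S_i. -/
theorem isJClass (i : Fin m) : IsJClass (P.term i.castSucc) (P.term i.succ) := by
  intro a ha b hb
  let J : SgIdeal S :=
    { carrier := (P.term i.succ).carrier ∪ (principalIdeal a).carrier
      mul_mem_left := fun s _ h =>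
        h.imp ((P.term i.succ).mul_mem_left s) ((principalIdeal a).mul_mem_left s)
      mul_mem_right := fun s _ h =>
        h.imp ((P.term i.succ).mul_mem_right s) ((principalIdeal a).mul_mem_right s) }
  have hJA : J.carrier ⊆ (P.term i.castSucc).carrier := by
    rintro s (hs | ⟨c, d, hs⟩)
    · exact (P.ssubset i).1 hs
    · exact (P.term i.castSucc).mem_of_coe_eq ha.1 hs
  have hZJ : (P.term i.succ).carrier ⊂ J.carrier :=
    ⟨Set.subset_union_left, fun h => ha.2 (h (Or.inr (self_mem_principalIdeal a)))⟩
  have hbJ : b ∈ J.carrier := by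
    by_contra hbJ
    exact P.no_between i J ⟨hZJ, hJA, fun h => hbJ (h hb.1)⟩
  exact hbJ.resolve_left hb.2

theorem exists_mem_layer (s : S) : ∃ i, s ∈ P.layer i := by
  by_contra! h
  have hs : ∀ k : Fin (m + 1), s ∈ (P.term k).carrier := by
    intro k
    induction k using Fin.induction with
    | zero => exact P.term_zero ▸ Set.mem_univ s
    | succ i ih => exact not_not.1 fun hs => h i ⟨ih, hs⟩
  have := hs (Fin.last m)
  rw [P.term_last] at this
  exact this

/-- The `i`-th layer is a subsemigroup with at least two `ℋ`-classes. -/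
def WideLayer (i : Fin m) : Prop :=
  IsWide (P.term i.castSucc) (P.term i.succ)

/-- The elements acting on the `i`-th layer without leaving it. -/
def act (i : Fin m) : Set S :=
  actSet (P.term i.castSucc) (P.term i.succ)

variable {P}

theorem layer_subset_act {i j : Fin m} {s : S} (hs : s ∈ P.act i) (hj : s ∈ P.layer j) :
    P.layer j ⊆ P.act i := by
  intro t ht
  obtain ⟨c, d, hcd⟩ := P.isJClass j t ht s hj
  obtain ⟨k, hk, hsk⟩ := hs
  exact mem_actSet_of_dvd hk.1 hsk.2 hcd

theorem notMem_of_mem_act {i : Fin m} {s : S} (hs : s ∈ P.act i) :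
    s ∉ (P.term i.succ).carrier := by
  obtain ⟨k, -, hsk⟩ := hs
  exact fun h => hsk.2 ((P.term i.succ).mul_mem_right _ h)

/-- F allows action from either side; on a wide layer the two sides are equivalent. -/
theorem WideLayer.union_eq_act {i : Fin m} (hW : P.WideLayer i) :
    P.F i ∪ P.layer i = P.act i := by
  apply Set.Subset.antisymm
  · rintro s (⟨-, j, hj, h | h⟩ | hs)
    · exact ⟨j, right_mem_diff hj h, (P.term i.castSucc).mul_mem_left _ hj, h⟩
    · have hj' := left_mem_diff hj h
      refine ⟨j, hj', (P.term i.castSucc).mul_mem_left _ hj, fun h' => ?_⟩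
      refine (hW.1 _ ⟨(P.term i.castSucc).mul_mem_right _ hj, h⟩ j hj').2 ?_
      rw [mul_assoc]
      exact (P.term i.succ).mul_mem_left _ h'
    · exact hW.subset_actSet hs
  · intro s hs
    by_cases hsA : s ∈ (P.term i.castSucc).carrier
    · exact Or.inr ⟨hsA, notMem_of_mem_act hs⟩
    · obtain ⟨j, hj, hsj⟩ := hs
      exact Or.inl ⟨hsA, j, hj.1, Or.inl hsj.2⟩

/-- Acting is constant on layers, and the bound j ≤ i is automatic because elements of S_{i+1} send
the layer into S_{i+1}. -/
theorem WideLayer.stem_eq_act {i : Fin m} (hW : P.WideLayer i) : P.stem i = P.act i := by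
  apply Set.Subset.antisymm
  · intro s hs
    simp only [stem, starSet, Set.mem_iUnion] at hs
    obtain ⟨j, ⟨-, hj⟩, hs⟩ := hs
    rw [← hW.union_eq_act]
    exact hj hs
  · intro s hs
    obtain ⟨j, hj⟩ := P.exists_mem_layer s
    simp only [stem, starSet, Set.mem_iUnion]
    refine ⟨j, ⟨?_, ?_⟩, hj⟩
    · by_contra! hij
      have hle : i.succ ≤ j.castSucc := by
        rw [Fin.le_def]
        exact hij
      exact notMem_of_mem_act hs (P.antitone_term hle hj.1)
    · rw [hW.union_eq_act]
      exact layer_subset_act hs hj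

theorem WideLayer.layer_subset_stem {i : Fin m} (hW : P.WideLayer i) :
    P.layer i ⊆ P.stem i := by
  rw [hW.stem_eq_act]
  exact hW.subset_actSet

end Layers

/-! ### Edges, roots and distances in stems. -/

section Finite

variable {S : Type*} [Semigroup S] [Finite S] {m : ℕ} {P : PrincipalSeries S m}

theorem wideLayer_of_not_factorNilpotent (hS : IsPseudoNilpotent S) {i : Fin m}
    (h : ¬ P.FactorNilpotent i) : P.WideLayer i := by
  set A := P.term i.castSucc with hA
  set Z := P.term i.succ with hZ
  have : Finite (Z.restrict A.toSubsemigroup).ReesFactor :=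
    Finite.of_surjective (Z.restrict A.toSubsemigroup).toFactor Quot.mk_surjective
  obtain ⟨q, hq⟩ := exists_loop_of_not_isMalcevNilpotent h
  have htop : (⊤ : Subsemigroup A.toSubsemigroup).map
      (toFactorHom (Z.restrict A.toSubsemigroup)) = ⊤ := by
    refine eq_top_iff.2 fun s _ => ?_
    obtain ⟨a, rfl⟩ := Quot.mk_surjective s
    exact ⟨a, trivial, rfl⟩
  rw [← adjoinOne_top, ← htop] at hq
  obtain ⟨p, -, -, h3, h4, hp⟩ := exists_loop_of_loop_factor _ (C := ⊤)
    (by rw [htop]; trivial) (by rw [htop]; trivial) hq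
  have hp' := hp.map_of_injective (MulMemClass.subtype A.toSubsemigroup) Subtype.val_injective
  rw [Subsemigroup.map_subtype_top] at hp'
  exact (P.isJClass i).isWide_of_loop hS hp' p.1.2 p.2.2 h3 h4

/-- With all multipliers 1, a spread pair stays spread, so λ_n ≠ ρ_n in the factor for every n. -/
theorem WideLayer.not_factorNilpotent {i : Fin m} (hW : P.WideLayer i) :
    ¬ P.FactorNilpotent i := by
  rintro ⟨n, -, h⟩
  set A := P.term i.castSucc with hA
  set Z := P.term i.succ with hZ
  obtain ⟨a, ha, b, hb, hab⟩ := hW.2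
  let I := Z.restrict A.toSubsemigroup
  let x : A.toSubsemigroup := ⟨a, ha.1⟩
  let y : A.toSubsemigroup := ⟨b, hb.1⟩
  have key : ∀ n, ∃ u v : A.toSubsemigroup, IsSpread A Z ((u : S), (v : S)) ∧
      malcevPair (I.toFactor x) (I.toFactor y) 1 n = (I.toFactor u, I.toFactor v) := by
    intro n
    induction n with
    | zero => exact ⟨x, y, ⟨ha, hb, hab⟩, rfl⟩
    | succ n ih =>
      obtain ⟨u, v, huv, he⟩ := ih
      exact ⟨u * v, v * u, huv.mul (P.isJClass i) hW, by rw [malcevPair_succ, he]; rfl⟩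
  obtain ⟨u, v, huv, he⟩ := key n
  have h' : (malcevPair (I.toFactor x) (I.toFactor y) 1 n).1 =
      (malcevPair (I.toFactor x) (I.toFactor y) 1 n).2 := h _ _ _
  rw [he] at h'
  rcases (toFactor_eq_iff I).1 h' with h' | h'
  · exact huv.ne (P.isJClass i) hW (congrArg Subtype.val h')
  · exact huv.1.2 h'.1

/-- The ends of an edge act on a common wide layer. -/
theorem exists_wideLayer_of_adj (hS : IsPseudoNilpotent S) (P : PrincipalSeries S m) {x y : S}
    (h : (upperNonNilpotentGraph S).Adj x y) :
    ∃ i, P.WideLayer i ∧ x ∈ P.act i ∧ y ∈ P.act i := by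
  obtain ⟨p, h1, h2, hp⟩ := adj_iff_exists_loop.1 h
  obtain ⟨i, hi⟩ := P.exists_mem_layer p.1
  have hi2 : p.2 ∈ P.layer i :=
    ⟨(hp.mem_ideal _ (Or.inl hi.1)).2, fun h => hi.2 (hp.mem_ideal _ (Or.inr h)).1⟩
  -- The multipliers of p may lie above the layer. Pseudo-nilpotency applied to p itself yields a
  -- loop with multipliers in ⟨p.1, p.2⟩¹, as `isWide_of_loop` requires.
  obtain ⟨r, hr1, hr2, hr3, hr4, hr⟩ :=
    hS.exists_loop .refl (hp.mono (Set.subset_univ _)) (P.term i.succ) hi.2 hi2.2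
  have hle : Subsemigroup.closure {p.1, p.2} ≤ (P.term i.castSucc).toSubsemigroup := by
    rw [Subsemigroup.closure_le]
    rintro s (rfl | rfl)
    exacts [hi.1, hi2.1]
  have hW : P.WideLayer i :=
    (P.isJClass i).isWide_of_loop hS (hr.mono (adjoinOne_mono hle)) (hle hr1) (hle hr2)
      hr3 hr4
  have hpp := hW.1 _ hi _ hi
  refine ⟨i, hW, ?_, ?_⟩
  · obtain ⟨c, d, hcd⟩ := hp.mem_principalIdeal h1 h2
    exact mem_actSet_of_dvd hi.1 hpp.2 hcd
  · rw [Set.pair_comm] at hp h1 h2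
    obtain ⟨c, d, hcd⟩ := hp.mem_principalIdeal h1 h2
    exact mem_actSet_of_dvd hi.1 hpp.2 hcd

/-- An edge from layer i into S_{i+1} would give a lower wide layer j on which layer i acts. Since
sa stays in layer i, every s acting on layer i would act on layer j too, against maximality of i. -/
theorem WideLayer.isRoot_of_maximal (hS : IsPseudoNilpotent S) {i : Fin m} {x y : S}
    (hW : P.WideLayer i) (hx : x ∈ P.act i) (hy : y ∈ P.act i)
    (hmax : ∀ j, P.WideLayer j → x ∈ P.act j → y ∈ P.act j → j ≤ i) : P.IsRoot i := by
  refine ⟨hW.not_factorNilpotent, fun a ha b hb hab => ?_⟩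
  obtain ⟨j, hWj, haj, hbj⟩ := exists_wideLayer_of_adj hS P hab
  have hij : i < j := by
    by_contra! hji
    have hle : j.succ ≤ i.succ := Fin.succ_le_succ_iff.2 hji
    exact notMem_of_mem_act hbj (P.antitone_term hle hb)
  have key : ∀ {s : S}, s ∈ P.act i → s ∈ P.act j := by
    intro s hs
    obtain ⟨k, hk⟩ := P.layer_nonempty j
    have hsa := layer_subset_act haj ha (hW.act hs ha).1
    exact ⟨a * k, (hWj.act haj hk).1, by rw [← mul_assoc]; exact (hWj.act hsa hk).1⟩
  exact absurd (hmax j hWj (key hx) (key hy)) (not_le.2 hij)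

/-- The ends of an edge lie in a common stem. -/
theorem exists_isRoot_of_adj (hS : IsPseudoNilpotent S) (P : PrincipalSeries S m) {x y : S}
    (h : (upperNonNilpotentGraph S).Adj x y) :
    ∃ i, P.IsRoot i ∧ x ∈ P.stem i ∧ y ∈ P.stem i := by
  have hne : {i | P.WideLayer i ∧ x ∈ P.act i ∧ y ∈ P.act i}.Nonempty :=
    exists_wideLayer_of_adj hS P h
  obtain ⟨i, hi⟩ := (Set.toFinite {i | P.WideLayer i ∧ x ∈ P.act i ∧ y ∈ P.act i}).exists_maximal
    hne
  obtain ⟨hW, hx, hy⟩ := hi.1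
  refine ⟨i, hW.isRoot_of_maximal hS hx hy fun j h1 h2 h3 => ?_, ?_, ?_⟩
  · exact (le_total j i).elim id fun hij => hi.2 ⟨h1, h2, h3⟩ hij
  · rwa [hW.stem_eq_act]
  · rwa [hW.stem_eq_act]

theorem IsRoot.wideLayer (hS : IsPseudoNilpotent S) {i : Fin m} (hi : P.IsRoot i) :
    P.WideLayer i :=
  wideLayer_of_not_factorNilpotent hS hi.1

theorem exists_isPath_of_adj_or {V : Type*} {G : SimpleGraph V} {s t : V} (hst : s ≠ t)
    (h : G.Adj s t ∨ ∃ a, G.Adj s a ∧ G.Adj t a) : ∃ p : G.Walk s t, p.IsPath ∧ p.length ≤ 2 := by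
  rcases h with h | ⟨a, h1, h2⟩
  · exact ⟨h.toWalk, by simp [h.ne], by simp⟩
  · exact ⟨.cons h1 h2.symm.toWalk, by simp [h1.ne, h2.ne', hst], by simp⟩

theorem WideLayer.exists_isPath (hS : IsPseudoNilpotent S) {i : Fin m} (hW : P.WideLayer i)
    (s t : P.stem i) (hst : s ≠ t) :
    ∃ p : ((upperNonNilpotentGraph S).induce (P.stem i)).Walk s t, p.IsPath ∧ p.length ≤ 2 := by
  apply exists_isPath_of_adj_or hst
  have hs : (s : S) ∈ P.act i := hW.stem_eq_act ▸ s.2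
  have ht : (t : S) ∈ P.act i := hW.stem_eq_act ▸ t.2
  refine (adj_or_exists_common_neighbour hS (P.isJClass i) hW hs ht).imp id ?_
  rintro ⟨a, ha, h1, h2⟩
  exact ⟨⟨a, hW.layer_subset_stem ha⟩, h1, h2⟩

theorem WideLayer.connected (hS : IsPseudoNilpotent S) {i : Fin m} (hW : P.WideLayer i) :
    ((upperNonNilpotentGraph S).induce (P.stem i)).Connected := by
  obtain ⟨k, hk⟩ := P.layer_nonempty i
  have : Nonempty (P.stem i) := ⟨⟨k, hW.layer_subset_stem hk⟩⟩
  refine ⟨fun s t => ?_⟩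
  by_cases hst : s = t
  · exact hst ▸ .refl _
  · exact (hW.exists_isPath hS s t hst).choose.reachable

theorem WideLayer.exists_walk_of_subset (hS : IsPseudoNilpotent S) {i : Fin m}
    (hW : P.WideLayer i) {X : Set S} (hX : P.stem i ⊆ X) {s t : X} (hs : (s : S) ∈ P.stem i)
    (ht : (t : S) ∈ P.stem i) :
    ∃ p : ((upperNonNilpotentGraph S).induce X).Walk s t, p.length ≤ 2 := by
  by_cases hst : s = t
  · exact hst ▸ ⟨.nil, by simp⟩
  · obtain ⟨p, -, hp⟩ := hW.exists_isPath hS ⟨s, hs⟩ ⟨t, ht⟩ fun h => hst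
      (Subtype.ext (congrArg Subtype.val h :))
    exact ⟨p.map ((upperNonNilpotentGraph S).induceHomOfLE hX).toHom,
      (SimpleGraph.Walk.length_map _ _).trans_le hp⟩

end Finite

end PrincipalSeries

/-! ### The global assertions on K, components and connections. -/

namespace PrincipalSeries

variable {S : Type*} [Semigroup S] [Finite S] {m : ℕ} {P : PrincipalSeries S m}

/-- The minimal ideal lies in every S_j, so it is contained in no F_j and would be isolated if it
were not a root. Below it is the empty ideal, so every element acts on it. -/
theorem exists_isRoot_of_K_eq_empty [Nonempty S] (hS : IsPseudoNilpotent S) (hK : P.K = ∅) :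
    ∃ i, P.IsRoot i ∧ P.stem i = Set.univ := by
  obtain ⟨s⟩ := ‹Nonempty S›
  obtain ⟨i₀, -⟩ := P.exists_mem_layer s
  obtain ⟨n, rfl⟩ : ∃ n, m = n + 1 := ⟨m - 1, by have := i₀.pos; omega⟩
  have hroot : P.IsRoot (Fin.last n) := by
    obtain ⟨k, hk⟩ := P.layer_nonempty (Fin.last n)
    by_contra hroot
    have hiso : P.IsIsolatedSubset (Fin.last n) := by
      refine ⟨hroot, fun j hj => ?_⟩
      exact absurd (P.antitone_term (Fin.castSucc_le_castSucc_iff.2 (Fin.le_last j)) hk.1) (hj hk).1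
    have hkK : k ∈ P.K := Set.mem_biUnion (show Fin.last n ∈ {i | P.IsIsolatedSubset i} from hiso) hk
    rw [hK] at hkK
    exact hkK
  have hW := hroot.wideLayer hS
  refine ⟨Fin.last n, hroot, Set.eq_univ_of_forall fun t => ?_⟩
  obtain ⟨k, hk⟩ := P.layer_nonempty (Fin.last n)
  rw [hW.stem_eq_act]
  refine ⟨k, hk, (P.term _).mul_mem_left _ hk.1, fun h => ?_⟩
  rw [Fin.succ_last, P.term_last] at h
  exact h

theorem exists_walk_of_stem_eq_univ (hS : IsPseudoNilpotent S) {i : Fin m} (hW : P.WideLayer i)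
    (h : P.stem i = Set.univ) {s t : S} (hst : s ≠ t) :
    ∃ p : (upperNonNilpotentGraph S).Walk s t, p.IsPath ∧ p.length ≤ 2 := by
  apply exists_isPath_of_adj_or hst
  have hact : ∀ s, s ∈ P.act i := fun s => by
    rw [← hW.stem_eq_act, h]
    trivial
  refine (adj_or_exists_common_neighbour hS (P.isJClass i) hW (hact s) (hact t)).imp id ?_
  rintro ⟨a, -, h1, h2⟩
  exact ⟨a, h1, h2⟩

/-- If an edge from u in a stem lay in a different stem, the whole layer of u would be in both,
hence a connection. So walks never leave the stem. -/
theorem component_eq_stem (hS : IsPseudoNilpotent S)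
    (hcon : ∀ j i₁ i₂ : Fin m, ¬ P.IsConnection j i₁ i₂)
    {C : (upperNonNilpotentGraph S).ConnectedComponent} (hC : C.supp.Nontrivial) :
    ∃ i : Fin m, P.IsRoot i ∧ C.supp = P.stem i := by
  obtain ⟨x, hx, y, hy, hxy⟩ := hC
  have hreach : (upperNonNilpotentGraph S).Reachable x y :=
    SimpleGraph.ConnectedComponent.exact (hx.trans hy.symm)
  obtain ⟨z, hxz⟩ : ∃ z, (upperNonNilpotentGraph S).Adj x z := by
    obtain ⟨p⟩ := hreach
    cases p with
    | nil => exact absurd rfl hxy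
    | cons h _ => exact ⟨_, h⟩
  obtain ⟨i, hi, hxi, -⟩ := exists_isRoot_of_adj hS P hxz
  have hW := hi.wideLayer hS
  have hstep : ∀ {u v : S}, u ∈ P.stem i → (upperNonNilpotentGraph S).Adj u v → v ∈ P.stem i := by
    intro u v hu huv
    obtain ⟨j, hj, huj, hvj⟩ := exists_isRoot_of_adj hS P huv
    have hWj := hj.wideLayer hS
    by_cases he : P.stem i = P.stem j
    · rwa [he]
    · obtain ⟨k, hk⟩ := P.exists_mem_layer u
      refine absurd ⟨hi, hj, he, Set.subset_inter ?_ ?_⟩ (hcon k i j)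
      · rw [hW.stem_eq_act] at hu ⊢
        exact layer_subset_act hu hk
      · rw [hWj.stem_eq_act] at huj ⊢
        exact layer_subset_act huj hk
  have hwalk : ∀ {u v : S}, (upperNonNilpotentGraph S).Walk u v → u ∈ P.stem i → v ∈ P.stem i := by
    intro u v p
    induction p with
    | nil => exact id
    | cons h _ ih => exact fun hu => ih (hstep hu h)
  refine ⟨i, hi, Set.Subset.antisymm (fun u hu => ?_) (fun u hu => ?_)⟩
  · obtain ⟨p⟩ : (upperNonNilpotentGraph S).Reachable x u :=
      SimpleGraph.ConnectedComponent.exact (hx.trans hu.symm)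
    exact hwalk p hxi
  · have h := (hW.connected hS).preconnected ⟨u, hu⟩ ⟨x, hxi⟩
    have h' : (upperNonNilpotentGraph S).Reachable u x :=
      h.map (SimpleGraph.Embedding.induce (P.stem i)).toHom
    exact (SimpleGraph.ConnectedComponent.sound h').trans hx

/-- Any element of the connecting layer is within distance 2 of every element of either stem. -/
theorem exists_walk_of_isConnection (hS : IsPseudoNilpotent S) {j i₁ i₂ : Fin m}
    (h : P.IsConnection j i₁ i₂) (s t : ↥(P.stem i₁ ∪ P.stem i₂)) :
    ∃ p : ((upperNonNilpotentGraph S).induce (P.stem i₁ ∪ P.stem i₂)).Walk s t,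
      p.length ≤ 4 := by
  obtain ⟨h1, h2, -, hj⟩ := h
  have hW1 := h1.wideLayer hS
  have hW2 := h2.wideLayer hS
  obtain ⟨k, hk⟩ := P.layer_nonempty j
  let c : ↥(P.stem i₁ ∪ P.stem i₂) := ⟨k, Or.inl (hj hk).1⟩
  have hc : ∀ u : ↥(P.stem i₁ ∪ P.stem i₂),
      ∃ p : ((upperNonNilpotentGraph S).induce (P.stem i₁ ∪ P.stem i₂)).Walk u c,
        p.length ≤ 2 := by
    intro u
    rcases u.2 with hu | hu
    · exact hW1.exists_walk_of_subset hS Set.subset_union_left hu (hj hk).1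
    · exact hW2.exists_walk_of_subset hS Set.subset_union_right hu (hj hk).2
  obtain ⟨p, hp⟩ := hc s
  obtain ⟨q, hq⟩ := hc t
  refine ⟨p.append q.reverse, ?_⟩
  rw [SimpleGraph.Walk.length_append, SimpleGraph.Walk.length_reverse]
  omega

end PrincipalSeries

theorem mainTheorem8 {S : Type*} [Semigroup S] [Finite S] [Nonempty S]
    (hS : IsPseudoNilpotent S) {m : ℕ} (P : PrincipalSeries S m) :
    (∀ i : Fin m, P.IsRoot i →
      ((upperNonNilpotentGraph S).induce (P.stem i)).Connected ∧
      ∀ s t : P.stem i, s ≠ t →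
        ∃ p : ((upperNonNilpotentGraph S).induce (P.stem i)).Walk s t,
          p.IsPath ∧ p.length ≤ 2) ∧
    (P.K = ∅ →
      (∃ i : Fin m, P.IsRoot i ∧ P.stem i = Set.univ) ∧
      (upperNonNilpotentGraph S).Connected ∧
      ∀ s t : S, s ≠ t →
        ∃ p : (upperNonNilpotentGraph S).Walk s t, p.IsPath ∧ p.length ≤ 2) ∧
    ((∀ j i₁ i₂ : Fin m, ¬ P.IsConnection j i₁ i₂) →
      ∀ C : (upperNonNilpotentGraph S).ConnectedComponent, C.supp.Nontrivial →
        (∃ i : Fin m, P.IsRoot i ∧ C.supp = P.stem i) ∧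
        ∃ T : Subsemigroup S, (T : Set S) = C.supp) ∧
    (∀ j i₁ i₂ : Fin m, P.IsConnection j i₁ i₂ →
      ((upperNonNilpotentGraph S).induce (P.stem i₁ ∪ P.stem i₂)).Connected ∧
      ∀ (s t : ↥(P.stem i₁ ∪ P.stem i₂))
        (p : ((upperNonNilpotentGraph S).induce (P.stem i₁ ∪ P.stem i₂)).Walk s t),
        p.IsPath →
        p.length = ((upperNonNilpotentGraph S).induce (P.stem i₁ ∪ P.stem i₂)).dist s t →
        p.length ≤ 4) := by
  refine ⟨fun i hi => ⟨(hi.wideLayer hS).connected hS, (hi.wideLayer hS).exists_isPath hS⟩,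
    fun hK => ?_, fun hcon C hC => ?_, fun j i₁ i₂ h => ⟨?_, fun s t p _ hp => ?_⟩⟩
  · obtain ⟨i, hi, hu⟩ := PrincipalSeries.exists_isRoot_of_K_eq_empty hS hK
    have hpath : ∀ s t : S, s ≠ t →
        ∃ p : (upperNonNilpotentGraph S).Walk s t, p.IsPath ∧ p.length ≤ 2 := fun s t hst =>
      PrincipalSeries.exists_walk_of_stem_eq_univ hS (hi.wideLayer hS) hu hst
    refine ⟨⟨i, hi, hu⟩, ⟨fun s t => ?_⟩, hpath⟩
    by_cases hst : s = t
    · exact hst ▸ .refl _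
    · exact (hpath s t hst).choose.reachable
  · obtain ⟨i, hi, he⟩ := PrincipalSeries.component_eq_stem hS hcon hC
    have hW := hi.wideLayer hS
    have hact : C.supp = P.act i := he.trans hW.stem_eq_act
    refine ⟨⟨i, hi, he⟩, ⟨C.supp, fun {a b} ha hb => ?_⟩, rfl⟩
    rw [hact] at ha hb ⊢
    exact hW.mul_mem_actSet ha hb
  · obtain ⟨k, hk⟩ := P.layer_nonempty j
    have : Nonempty ↥(P.stem i₁ ∪ P.stem i₂) := ⟨⟨k, Or.inl (h.2.2.2 hk).1⟩⟩
    exact ⟨fun s t => (PrincipalSeries.exists_walk_of_isConnection hS h s t).choose.reachable⟩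
  · obtain ⟨q, hq⟩ := PrincipalSeries.exists_walk_of_isConnection hS h s t
    exact hp.trans_le ((SimpleGraph.dist_le q).trans hq)
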